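/- Let $\mathbb N_0=\{0,1,2,\dots\}$. For $n\in\mathbb N_0$ let $P(n)$ be the set of partitions of $n$, let $Q(n)\subseteq P(n)$ be the set of partitions of $n$ into distinct parts, let $q_o(n)$ be the number of $\lambda\in Q(n)$ all of whose parts are odd, and let $\|\lambda\|$ be the number of parts of $\lambda$. Put $$q^{\pm}(n)=\sum_{\lambda\in Q(n)}(-1)^{\|\lambda\|},\qquad p^{\pm}(n)=\sum_{\lambda\in P(n)}(-1)^{\|\lambda\|}.$$ A function $f:\mathbb N_0\to\mathbb Z$ is called a PIO (polynomial in input and output) function if there are positive integers $c,d$ and a multitape Turing machine that, for every $n\in\mathbb N_0$, given the binary code of $n$, outputs the binary code of $f(n)$ in at most $c\cdot m_f(n)^d$ steps, where $m_f(n)=\log(1+n)+\log(2+|f(n)|)$. Proposition. Both $q^{\pm}$ and $p^{\pm}$ are PIO functions; moreover, $q^{\pm}(n)$ can be computed by a multitape Turing machine in $O(\log^d(2+n))$ steps for some $d$. Concretely, as identities of formal power series over $\mathbb Z$ (with coefficientwise convergence of infinite sums and products), $$\sum_{n=0}^{\infty}q^{\pm}(n)q^n=\prod_{k=1}^{\infty}(1-q^k)=1+\sum_{n=1}^{\infty}(-1)^n\left(q^{n(3n-1)/2}+q^{n(3n+1)/2}\right)$$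 and $$\sum_{n=0}^{\infty}p^{\pm}(n)q^n=\prod_{k=1}^{\infty}\frac{1}{1+q^k}=\prod_{k=1}^{\infty}\left(1+(-q)^{2k-1}\right)=1+\sum_{n=1}^{\infty}(-1)^nq_o(n)q^n.$$ -/

import Mathlib

open scoped PowerSeries PowerSeries.WithPiTopology

/-- Binary code of an integer: a sign bit (`true` for negative numbers), followed by the binary
digits of the absolute value, least significant digit first. -/
def encodeInt (z : ℤ) : List Bool :=
  decide (z < 0) :: Computability.encodeNat z.natAbs

/-- `f` is computed, within `T n` steps on every input `n`, by one Turing machine that reads the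
binary code of `n` and prints the binary code of `f n`. The machine model is Mathlib's
`Turing.FinTM2`: finitely many memory tapes (used as stacks), finitely many labels and internal
states, and here also finite alphabets on all tapes; the input and output alphabet is `Bool`. -/
def ComputableWithin (f : ℕ → ℤ) (T : ℕ → ℝ) : Prop :=
  ∃ M : Turing.TM2ComputableAux Bool Bool,
    (∀ k : M.tm.K, Finite (M.tm.Γ k)) ∧
    ∀ n : ℕ, ∃ t : ℕ, (t : ℝ) ≤ T n ∧
      Nonempty (Turing.TM2OutputsInTime M.tm
        ((Computability.encodeNat n).map M.inputAlphabet.invFun)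
        (some ((encodeInt (f n)).map M.outputAlphabet.invFun)) t)

/-- The combined complexity `m_f(n)` of the input and the output. -/
noncomputable def inOutSize (f : ℕ → ℤ) (n : ℕ) : ℝ :=
  Real.log (1 + (n : ℝ)) + Real.log (2 + |(f n : ℝ)|)

/-- `f` is a PIO (polynomial in input and output) function. -/
def IsPIO (f : ℕ → ℤ) : Prop :=
  ∃ c d : ℕ, 0 < c ∧ 0 < d ∧ ComputableWithin f (fun n => (c : ℝ) * inOutSize f n ^ d)

/-- The signed count of the partitions of `n` into distinct parts. -/
def qSigned (n : ℕ) : ℤ :=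
  ∑ l ∈ Nat.Partition.distincts n, (-1 : ℤ) ^ Multiset.card l.parts

/-- The signed count of all partitions of `n`. -/
def pSigned (n : ℕ) : ℤ :=
  ∑ l : Nat.Partition n, (-1 : ℤ) ^ Multiset.card l.parts

/-- The number of partitions of `n` into distinct odd parts. -/
def qOdd (n : ℕ) : ℕ :=
  (Nat.Partition.oddDistincts n).card

/-! ### Structured stack programs and their compilation to `Turing.FinTM2` -/

/-! The power series identities come from weighting partitions by multiplicities. A part with weight
-1 at multiplicity one gives the factor 1 - X^k, and the pentagonal number theorem then expands the
product. The weight (-1)^c at multiplicity c gives the inverse of 1 + X^k. Euler's factorisation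
∏(1+X^k) · ∏(1-X^(2k-1)) = 1 turns the product of these inverses into ∏(1-X^(2k-1)), whose
coefficients are (-1)^n `qOdd n` (`mk_pSigned`).

For the complexity of `qSigned`, note that n is pentagonal exactly when 24n+1 = (6k-1)^2 for some
integer k, and the parity of k can be read off the root modulo 12. The schoolbook square root in
base 4 decides this in O(log^2) steps (`SqrtMachine.runs_prog`, `qSigned_of_sq`, `qSigned_eq_zero`).

For `pSigned`, time polynomial in n is enough, because the output is long: `qOdd n` is at least 2^m
with m about √n (`two_pow_le_qOdd`), so n+1 is at most a constant times the square of `inOutSize`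
(`succ_le_inOutSize_pSigned`). Such a computation exists by Kronecker substitution: with B =
2^(n+1), the number `qOdd n` is the n-th base-B digit of ∏_{k<n} (1 + B^(2k+1)), a product formed by
n shifts and additions (`qOdd_eq_digit`, `DigitMachine.runs_prog`).

Both algorithms are written as structured stack programs. `Exec.iterate_step` shows that the
compiled machine follows the big-step semantics step for step, so that correctness and running time
are proved on programs only. -/

/-- Structured programs over a family of stacks with alphabets `Γ k`. `case k f` pops the stack `k`
and continues with `f` of the result; `loop k f` pops the stack `k` and runs `f` on the popped
symbol, until the stack is found empty. -/
inductive StackProg {K : Type} (Γ : K → Type) : Type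
  | skip : StackProg Γ
  | push (k : K) (a : Γ k) : StackProg Γ
  | seq (p q : StackProg Γ) : StackProg Γ
  | case (k : K) (f : Option (Γ k) → StackProg Γ) : StackProg Γ
  | loop (k : K) (f : Γ k → StackProg Γ) : StackProg Γ

namespace StackProg

open Function (update)

variable {K : Type} {Γ : K → Type}

scoped infixr:60 " ;; " => StackProg.seq

/-- The labels of the machine code of a program. -/
def Label : StackProg Γ → Type
  | skip => Unit
  | push _ _ => Unit
  | seq p q => p.Label ⊕ q.Label
  | case _ f => Option (Σ x, (f x).Label)
  | loop _ f => Option (Σ a, (f a).Label)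

/-- The label at which the execution of a program begins. -/
def entry : (p : StackProg Γ) → p.Label
  | skip => ()
  | push _ _ => ()
  | seq p _ => Sum.inl p.entry
  | case _ _ => none
  | loop _ _ => none

instance finite_label [∀ k, Finite (Γ k)] : (p : StackProg Γ) → Finite p.Label
  | skip => inferInstanceAs (Finite Unit)
  | push _ _ => inferInstanceAs (Finite Unit)
  | seq p q => by
    have := finite_label p
    have := finite_label q
    exact inferInstanceAs (Finite (p.Label ⊕ q.Label))
  | case k f => by
    have := fun x => finite_label (f x)
    exact inferInstanceAs (Finite (Option (Σ x, (f x).Label)))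
  | loop k f => by
    have := fun x => finite_label (f x)
    exact inferInstanceAs (Finite (Option (Σ x, (f x).Label)))

variable [DecidableEq K]

/-- The machine code of a program whose labels are placed by `emb`, and which jumps to `next` when
it is done. The internal state of the machine remembers the last symbol popped from each stack. -/
def code {Λ : Type} : (p : StackProg Γ) → (p.Label → Λ) → Λ → p.Label →
    Turing.TM2.Stmt Γ Λ (∀ k, Option (Γ k))
  | skip, _, next, _ => .goto fun _ => next
  | push k a, _, next, _ => .push k (fun _ => a) (.goto fun _ => next)
  | seq p q, emb, next, l =>
    Sum.elim (code p (fun l => emb (Sum.inl l)) (emb (Sum.inr q.entry)))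
      (code q (fun l => emb (Sum.inr l)) next) l
  | case k _, emb, _, none =>
    .pop k (fun v x => update v k x) (.goto fun v => emb (some ⟨v k, entry _⟩))
  | case _ f, emb, next, some ⟨x, l⟩ => code (f x) (fun l => emb (some ⟨x, l⟩)) next l
  | loop k _, emb, next, none =>
    .pop k (fun v x => update v k x)
      (.goto fun v => (v k).elim next fun a => emb (some ⟨a, entry _⟩))
  | loop _ f, emb, _, some ⟨a, l⟩ => code (f a) (fun l => emb (some ⟨a, l⟩)) (emb none) l

/-- `Exec p s t s'`: started on the stacks `s`, the program `p` takes `t` steps and leaves the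
stacks `s'`. -/
inductive Exec : StackProg Γ → (∀ k, List (Γ k)) → ℕ → (∀ k, List (Γ k)) → Prop
  | skip (s) : Exec skip s 1 s
  | push (k a s) : Exec (push k a) s 1 (update s k (a :: s k))
  | seq {p q s₁ t₁ s₂ t₂ s₃} : Exec p s₁ t₁ s₂ → Exec q s₂ t₂ s₃ →
      Exec (seq p q) s₁ (t₁ + t₂) s₃
  | case {k f s t s'} : Exec (f (s k).head?) (update s k (s k).tail) t s' →
      Exec (case k f) s (1 + t) s'
  | loop_nil {k f s} : s k = [] → Exec (loop k f) s 1 s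
  | loop_cons {k f s a l t₁ s₁ t₂ s₂} : s k = a :: l → Exec (f a) (update s k l) t₁ s₁ →
      Exec (loop k f) s₁ t₂ s₂ → Exec (loop k f) s (1 + t₁ + t₂) s₂

-- The register contents `v` are arbitrary on entry: every jump inspects only a symbol popped in the
-- same statement, so old register values never matter. The embedding and the exit label are
-- quantified inside the induction because subprograms occupy part of the label set of the whole
-- program.
open Turing in
theorem Exec.iterate_step {Λ : Type} {M : Λ → TM2.Stmt Γ Λ (∀ k, Option (Γ k))}
    {p : StackProg Γ} {s : ∀ k, List (Γ k)} {t : ℕ} {s' : ∀ k, List (Γ k)} (h : Exec p s t s') :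
    ∀ (emb : p.Label → Λ) (next : Λ), (∀ l, M (emb l) = code p emb next l) →
    ∀ v, ∃ v', (flip bind (TM2.step M))^[t] (some ⟨some (emb p.entry), v, s⟩) =
      some ⟨some next, v', s'⟩ := by
  induction h with
  | skip s =>
    intro emb next hM v
    refine ⟨v, ?_⟩
    simp [flip, hM, code]
  | push k a s =>
    intro emb next hM v
    refine ⟨v, ?_⟩
    simp [flip, hM, code]
  | @seq p q s₁ t₁ s₂ t₂ s₃ _ _ ih₁ ih₂ =>
    intro emb next hM v
    obtain ⟨v₁, h₁⟩ := ih₁ (fun l => emb (Sum.inl l)) (emb (Sum.inr q.entry))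
      (fun l => hM (Sum.inl l)) v
    obtain ⟨v₂, h₂⟩ := ih₂ (fun l => emb (Sum.inr l)) next (fun l => hM (Sum.inr l)) v₁
    refine ⟨v₂, ?_⟩
    rw [Nat.add_comm, Function.iterate_add_apply]
    exact (congrArg _ h₁).trans h₂
  | @case k f s t s' _ ih =>
    intro emb next hM v
    obtain ⟨v₁, h₁⟩ := ih (fun l => emb (some ⟨_, l⟩)) next (fun l => hM (some ⟨_, l⟩))
      (update v k (s k).head?)
    refine ⟨v₁, ?_⟩
    rw [Nat.add_comm, Function.iterate_add_apply, ← h₁]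
    congr 1
    have h0 : M (emb (StackProg.case k f).entry) = _ := hM none
    simp [flip, h0, code]
    exact congrArg (fun x => emb (some ⟨x, (f x).entry⟩)) (Function.update_self k _ v)
  | @loop_nil k f s hs =>
    intro emb next hM v
    refine ⟨update v k none, ?_⟩
    have h0 : M (emb (loop k f).entry) = _ := hM none
    have h1 : update s k [] = s := by rw [← hs]; simp
    simp [flip, h0, code, hs, h1]
  | @loop_cons k f s a l t₁ s₁ t₂ s₂ hs _ _ ih₁ ih₂ =>
    intro emb next hM v
    obtain ⟨v₁, h₁⟩ := ih₁ (fun l => emb (some ⟨_, l⟩)) (emb none) (fun l => hM (some ⟨_, l⟩))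
      (update v k (some a))
    obtain ⟨v₂, h₂⟩ := ih₂ emb next hM v₁
    refine ⟨v₂, ?_⟩
    rw [Nat.add_comm, Function.iterate_add_apply, Nat.add_comm 1, Function.iterate_add_apply, ← h₂]
    congr 1
    refine Eq.trans ?_ h₁
    congr 1
    have h0 : M (emb (loop k f).entry) = _ := hM none
    simp [flip, h0, code, hs]

/-- `Runs p s s' T`: started on `s`, the program `p` leaves `s'` after at most `T` steps. -/
def Runs (p : StackProg Γ) (s s' : ∀ k, List (Γ k)) (T : ℕ) : Prop :=
  ∃ t ≤ T, Exec p s t s'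

section Machine

variable [Fintype K] [∀ k, Finite (Γ k)]

/-- The machine that executes a program, with input on the stack `k₀` and output on `k₁`. -/
noncomputable def machine (p : StackProg Γ) (k₀ k₁ : K) : Turing.FinTM2 :=
  letI : Fintype (Option p.Label) := Fintype.ofFinite _
  letI : Fintype (∀ k, Option (Γ k)) := Fintype.ofFinite _
  letI : Fintype (Γ k₀) := Fintype.ofFinite _
  { K := K
    k₀ := k₀
    k₁ := k₁
    Γ := Γ
    Λ := Option p.Label
    main := some p.entry
    σ := ∀ k, Option (Γ k)
    initialState := fun _ => none
    m := fun l => l.elim (.load (fun _ _ => none) .halt) (code p some none) }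

omit [Fintype K] [∀ k, Finite (Γ k)] in
theorem dite_mpr_eq_update (k k₀ : K) (l : List (Γ k₀)) :
    (if h : k = k₀ then (congrArg (fun k => List (Γ k)) h).mpr l else []) =
      update (fun _ => []) k₀ l k := by
  by_cases hk : k = k₀
  · subst hk
    simp
  · rw [Function.update_of_ne hk, dif_neg hk]

/-- The additional step is spent at the exit label `none`: `haltList` demands the initial internal
state, so the registers are reset before halting. -/
theorem _root_.ComputableWithin.of_runs {f : ℕ → ℤ} {T : ℕ → ℝ} (p : StackProg Γ) (k₀ k₁ : K)
    (e₀ : Γ k₀ ≃ Bool) (e₁ : Γ k₁ ≃ Bool)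
    (h : ∀ n, ∃ t : ℕ, (t + 1 : ℝ) ≤ T n ∧
      Runs p (update (fun _ => []) k₀ ((Computability.encodeNat n).map e₀.symm))
        (update (fun _ => []) k₁ ((encodeInt (f n)).map e₁.symm)) t) :
    ComputableWithin f T := by
  refine ⟨⟨p.machine k₀ k₁, e₀, e₁⟩, fun k => (inferInstance : ∀ k, Finite (Γ k)) k, fun n => ?_⟩
  obtain ⟨T', hT, t, ht, hex⟩ := h n
  refine ⟨T' + 1, by push_cast; exact hT, ⟨⟨⟨t + 1, ?_⟩, Nat.succ_le_succ ht⟩⟩⟩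
  obtain ⟨v, hv⟩ := hex.iterate_step (M := (p.machine k₀ k₁).m) some none (fun _ => rfl)
    (fun _ => none)
  have hi : Turing.initList (p.machine k₀ k₁) ((Computability.encodeNat n).map e₀.symm) =
      ⟨some (some p.entry), fun _ => none,
        update (fun _ => []) k₀ ((Computability.encodeNat n).map e₀.symm)⟩ := by
    unfold Turing.initList
    congr 1
    funext k
    exact dite_mpr_eq_update ..
  have hh : Turing.haltList (p.machine k₀ k₁) ((encodeInt (f n)).map e₁.symm) =
      ⟨none, fun _ => none, update (fun _ => []) k₁ ((encodeInt (f n)).map e₁.symm)⟩ := by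
    unfold Turing.haltList
    congr 1
    funext k
    exact dite_mpr_eq_update ..
  change _ = some (Turing.haltList (p.machine k₀ k₁) ((encodeInt (f n)).map e₁.symm))
  change (flip bind (Turing.TM2.step (p.machine k₀ k₁).m))^[t + 1]
    (some (Turing.initList (p.machine k₀ k₁) ((Computability.encodeNat n).map e₀.symm))) = _
  rw [hi, hh, Function.iterate_succ_apply']
  refine (congrArg _ hv).trans ?_
  rfl

end Machine

/-! ### Rules for `Runs` -/

variable {p q : StackProg Γ} {s s' s₁ s₂ s₃ : ∀ k, List (Γ k)} {k : K}

theorem Runs.mono {T T' : ℕ} (h : Runs p s s' T) (hT : T ≤ T') : Runs p s s' T' :=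
  let ⟨t, ht, he⟩ := h
  ⟨t, ht.trans hT, he⟩

theorem Runs.conv {T T' : ℕ} (h : Runs p s s₁ T) (hs : s₁ = s') (hT : T ≤ T') : Runs p s s' T' :=
  hs ▸ h.mono hT

theorem runs_skip (s : ∀ k, List (Γ k)) : Runs skip s s 1 := ⟨1, le_rfl, .skip s⟩

theorem runs_push (k : K) (a : Γ k) (s : ∀ k, List (Γ k)) :
    Runs (push k a) s (update s k (a :: s k)) 1 := ⟨1, le_rfl, .push k a s⟩

theorem Runs.seq {T₁ T₂ : ℕ} (h₁ : Runs p s₁ s₂ T₁) (h₂ : Runs q s₂ s₃ T₂) :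
    Runs (p ;; q) s₁ s₃ (T₁ + T₂) :=
  let ⟨_, ht₁, he₁⟩ := h₁
  let ⟨_, ht₂, he₂⟩ := h₂
  ⟨_, add_le_add ht₁ ht₂, .seq he₁ he₂⟩

theorem Runs.case {T : ℕ} {f : Option (Γ k) → StackProg Γ}
    (h : Runs (f (s k).head?) (update s k (s k).tail) s' T) : Runs (case k f) s s' (1 + T) :=
  let ⟨_, ht, he⟩ := h
  ⟨_, Nat.add_le_add_left ht 1, .case he⟩

/-- A loop whose iterations change the state `S x` according to a fold. -/
theorem runs_loop_foldl {α : Type*} {f : Γ k → StackProg Γ} (step : α → Γ k → α)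
    (S : α → List (Γ k) → ∀ k, List (Γ k)) (P : α → List (Γ k) → Prop) (c : ℕ)
    (hS : ∀ x l, S x l k = l)
    (h : ∀ x a l, P x (a :: l) →
      P (step x a) l ∧ Runs (f a) (update (S x (a :: l)) k l) (S (step x a) l) c)
    (l : List (Γ k)) : ∀ x, P x l →
      Runs (loop k f) (S x l) (S (l.foldl step x) []) (l.length * (c + 1) + 1) := by
  induction l with
  | nil => exact fun x _ => ⟨1, by simp, .loop_nil (hS x [])⟩
  | cons a l ih =>
    intro x hx
    obtain ⟨hP, t₁, ht₁, he₁⟩ := h x a l hx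
    obtain ⟨t₂, ht₂, he₂⟩ := ih _ hP
    refine ⟨_, ?_, .loop_cons (hS x _) he₁ he₂⟩
    rw [List.length_cons]
    nlinarith

theorem runs_loop_nil {f : Γ k → StackProg Γ} (h : s k = []) : Runs (loop k f) s s 1 :=
  ⟨1, le_rfl, .loop_nil h⟩

theorem Runs.loop_cons {f : Γ k → StackProg Γ} {a : Γ k} {l : List (Γ k)} {T₁ T₂ : ℕ}
    (hs : s₁ k = a :: l) (h₁ : Runs (f a) (update s₁ k l) s₂ T₁) (h₂ : Runs (loop k f) s₂ s₃ T₂) :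
    Runs (loop k f) s₁ s₃ (1 + T₁ + T₂) :=
  let ⟨_, ht₁, he₁⟩ := h₁
  let ⟨_, ht₂, he₂⟩ := h₂
  ⟨_, add_le_add (Nat.add_le_add_left ht₁ 1) ht₂, .loop_cons hs he₁ he₂⟩

/-- Empty a stack. -/
def clear (k : K) : StackProg Γ := loop k fun _ => skip

theorem runs_clear (k : K) (s : ∀ k, List (Γ k)) :
    Runs (clear k) s (update s k []) (2 * (s k).length + 1) := by
  have := runs_loop_foldl (k := k) (f := fun _ => skip) (fun _ _ => ()) (fun _ l => update s k l)
    (fun _ _ => True) 1 (by simp) (by simp [runs_skip]) (s k) () trivial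
  simpa [mul_comm, clear] using this

theorem _root_.List.foldl_cons_map {α β : Type*} (f : α → β) (l : List α) (y : List β) :
    l.foldl (fun x a => f a :: x) y = (l.map f).reverse ++ y := by
  induction l generalizing y with
  | nil => rfl
  | cons a l ih => simp [ih]

/-- Move a stack onto another one, which reverses it. -/
def pour (i j : K) (f : Γ i → Γ j) : StackProg Γ := loop i fun a => push j (f a)

theorem runs_pour {i j : K} (hij : i ≠ j) (f : Γ i → Γ j) (s : ∀ k, List (Γ k)) :
    Runs (pour i j f) s (update (update s i []) j (((s i).map f).reverse ++ s j))
      (2 * (s i).length + 1) := by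
  have := runs_loop_foldl (k := i) (f := fun a => push j (f a)) (fun x a => f a :: x)
    (fun x l => update (update s i l) j x) (fun _ _ => True) 1
    (fun x l => by rw [Function.update_of_ne hij, Function.update_self])
    (fun x a l _ => ⟨trivial, ?_⟩) (s i) (s j) trivial
  · rw [List.foldl_cons_map, mul_comm] at this
    simpa [pour] using this
  · convert runs_push j (f a) _ using 1
    rw [Function.update_comm hij.symm]
    simp

/-- Sequencing itself costs no step, so rebracketing preserves the time. This is needed when a
branch of a `case` is itself a sequence, since the rules below peel off the head of a right-nested
program. -/
theorem Runs.assoc {r : StackProg Γ} {T : ℕ} (h : Runs (p ;; q ;; r) s s' T) :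
    Runs ((p ;; q) ;; r) s s' T := by
  obtain ⟨t, ht, he⟩ := h
  cases he with
  | seq h₁ h₂ =>
    cases h₂ with
    | seq h₂ h₃ =>
      refine ⟨_, ht, ?_⟩
      rw [← add_assoc]
      exact .seq (.seq h₁ h₂) h₃

theorem Runs.skip_seq {T : ℕ} (h : Runs q s s' T) : Runs (skip ;; q) s s' (1 + T) :=
  (runs_skip s).seq h

theorem Runs.push_seq {a : Γ k} {T : ℕ} (h : Runs q (update s k (a :: s k)) s' T) :
    Runs (push k a ;; q) s s' (1 + T) :=
  (runs_push k a s).seq h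

theorem Runs.case_seq {f : Option (Γ k) → StackProg Γ} {T : ℕ}
    (h : Runs (f (s k).head? ;; q) (update s k (s k).tail) s' T) :
    Runs (StackProg.case k f ;; q) s s' (1 + T) := by
  obtain ⟨t, ht, he⟩ := h
  cases he with
  | seq h₁ h₂ =>
    refine ⟨_, Nat.add_le_add_left ht 1, ?_⟩
    rw [← add_assoc]
    exact .seq (.case h₁) h₂

theorem Runs.clear_seq {T : ℕ} (h : Runs q (update s k []) s' T) :
    Runs (clear k ;; q) s s' (2 * (s k).length + 1 + T) :=
  (runs_clear k s).seq h

theorem Runs.pour_seq {i j : K} {f : Γ i → Γ j} {T : ℕ} (hij : i ≠ j)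
    (h : Runs q (update (update s i []) j (((s i).map f).reverse ++ s j)) s' T) :
    Runs (pour i j f ;; q) s s' (2 * (s i).length + 1 + T) :=
  (runs_pour hij f s).seq h

end StackProg

/-! ### Binary codes -/

section BinaryCodes

open Computability

/-- The number with the given binary digits, least significant digit first. -/
def bitsVal : List Bool → ℕ
  | [] => 0
  | b :: l => b.toNat + 2 * bitsVal l

theorem bitsVal_append (l m : List Bool) :
    bitsVal (l ++ m) = bitsVal l + 2 ^ l.length * bitsVal m := by
  induction l with
  | nil => simp [bitsVal]
  | cons b l ih => simp only [List.cons_append, bitsVal, ih, List.length_cons]; ring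

theorem bitsVal_replicate_false (n : ℕ) : bitsVal (List.replicate n false) = 0 := by
  induction n with
  | zero => rfl
  | succ n ih => simp [List.replicate_succ, bitsVal, ih]

theorem bitsVal_lt (l : List Bool) : bitsVal l < 2 ^ l.length := by
  induction l with
  | nil => simp [bitsVal]
  | cons b l ih =>
    rw [bitsVal, List.length_cons, pow_succ]
    have := b.toNat_le
    omega

theorem bitsVal_eq_zero_iff (l : List Bool) : bitsVal l = 0 ↔ ∀ b ∈ l, b = false := by
  induction l with
  | nil => simp [bitsVal]
  | cons b l ih => cases b <;> simp [bitsVal, ih]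

theorem encodeNat_bit1 (n : ℕ) : encodeNat (2 * n + 1) = true :: encodeNat n := by
  have h : ((2 * n + 1 : ℕ) : Num) = Num.bit1 (n : Num) := by
    have := Num.ofNat'_bit true n
    simpa [Nat.bit, Num.ofNat'_eq] using this
  unfold encodeNat
  rw [h]
  cases (n : Num) <;> rfl

theorem encodeNat_bit0 (n : ℕ) :
    encodeNat (2 * n) = if n = 0 then [] else false :: encodeNat n := by
  split_ifs with h0
  · subst h0; rfl
  have h : ((2 * n : ℕ) : Num) = Num.bit0 (n : Num) := by
    have := Num.ofNat'_bit false n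
    simpa [Nat.bit, Num.ofNat'_eq] using this
  have h1 : (n : Num) ≠ 0 := by exact_mod_cast h0
  unfold encodeNat
  rw [h]
  cases hn : (n : Num) with
  | zero => exact absurd hn h1
  | pos p => rfl

theorem bitsVal_encodeNat (n : ℕ) : bitsVal (encodeNat n) = n := by
  induction n using Nat.strong_induction_on with
  | _ n ih =>
    obtain ⟨m, rfl | rfl⟩ := Nat.even_or_odd' n
    · rw [encodeNat_bit0]
      split_ifs with h
      · simp [h, bitsVal]
      · simp [bitsVal, ih m (by omega)]
    · rw [encodeNat_bit1, bitsVal, ih m (by omega), Bool.toNat_true]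
      omega

theorem two_pow_length_encodeNat_le (n : ℕ) : 2 ^ (encodeNat n).length ≤ 2 * n + 1 := by
  induction n using Nat.strong_induction_on with
  | _ n ih =>
    obtain ⟨m, rfl | rfl⟩ := Nat.even_or_odd' n
    · rw [encodeNat_bit0]
      split_ifs with h
      · simp
      · rw [List.length_cons, pow_succ]
        have := ih m (by omega)
        -- Doubling the inductive bound loses one; evenness of the power improves 2m + 1 to 2m.
        have h2 : 2 ∣ 2 ^ (encodeNat m).length := by
          refine dvd_pow_self 2 ?_
          intro h0
          rw [List.length_eq_zero_iff] at h0
          have := bitsVal_encodeNat m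
          rw [h0, bitsVal] at this
          omega
        omega
    · rw [encodeNat_bit1, List.length_cons, pow_succ]
      have := ih m (by omega)
      omega

/-- Reading binary digits, most significant digit first, prefixes the code of a number by the
next digit but drops leading zeros. -/
def encodeStep (l : List Bool) (b : Bool) : List Bool :=
  if b then true :: l else if l = [] then [] else false :: l

theorem encodeStep_encodeNat (n : ℕ) (b : Bool) :
    encodeStep (encodeNat n) b = encodeNat (b.toNat + 2 * n) := by
  cases b
  · have : encodeNat n = [] ↔ n = 0 := by
      refine ⟨fun h => ?_, fun h => by rw [h]; rfl⟩
      rw [← bitsVal_encodeNat n, h, bitsVal]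
    simp [encodeStep, encodeNat_bit0, this]
  · simp [encodeStep, Nat.add_comm 1, encodeNat_bit1]

theorem foldr_encodeStep (l : List Bool) :
    l.foldr (fun b m => encodeStep m b) [] = encodeNat (bitsVal l) := by
  induction l with
  | nil => rfl
  | cons b l ih => rw [List.foldr_cons, ih, encodeStep_encodeNat, bitsVal]

theorem foldl_reverse_bits (l : List Bool) :
    l.reverse.foldl (fun u b => b.toNat + 2 * u) 0 = bitsVal l := by
  rw [List.foldl_reverse]
  induction l with
  | nil => rfl
  | cons b l ih => rw [List.foldr_cons, ih, bitsVal]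

end BinaryCodes

/-! ### Generating functions -/

-- This is the partition generating function whose weight is `a` for an admissible part of
-- multiplicity one and 0 otherwise. A repeated or inadmissible part annihilates its partition, and
-- each factor keeps a single term. The choices a = ±1, with all parts or only odd parts, give every
-- product over distinct parts needed below.
open PowerSeries PowerSeries.WithPiTopology in
theorem hasProd_distincts_pow_card {R : Type*} [CommRing R] [TopologicalSpace R] [T2Space R]
    (a : R) (p : ℕ → Prop) [DecidablePred p] :
    HasProd (fun i => if p (i + 1) then 1 + C a * X ^ (i + 1) else (1 : R⟦X⟧))
      (PowerSeries.mk fun n => ∑ l ∈ Nat.Partition.distincts n with ∀ i ∈ l.parts, p i,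
        a ^ Multiset.card l.parts) := by
  convert! Nat.Partition.hasProd_genFun
    (fun i c => if p i ∧ c = 1 then a else 0) using 1
  · ext1 i
    -- The summation index is the multiplicity minus one.
    rw [tsum_eq_single 0 (by intro j hj; simp [hj])]
    by_cases h : p (i + 1) <;> simp [h, smul_eq_C_mul]
  · unfold Nat.Partition.genFun Nat.Partition.distincts
    congr 1
    funext n
    rw [Finset.filter_filter, Finset.sum_filter]
    refine Finset.sum_congr rfl fun l _ => ?_
    rw [Finsupp.prod]
    split_ifs with h
    · rw [Finset.prod_congr rfl (g := fun _ => a), Finset.prod_const]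
      · rw [Multiset.toFinsupp_support, ← Multiset.toFinset_card_of_nodup h.1]
      · intro i hi
        have hi' : i ∈ l.parts := by simpa using hi
        simp [h.2 i hi', Multiset.count_eq_one_of_mem h.1 hi']
    · symm
      rw [not_and_or, Multiset.nodup_iff_count_le_one] at h
      push Not at h
      obtain ⟨i, hi⟩ | ⟨i, hi, hi'⟩ := h
      · refine Finset.prod_eq_zero (i := i) ?_ ?_
        · simp only [Multiset.toFinsupp_support, Multiset.mem_toFinset]
          exact Multiset.count_pos.1 (by omega)
        · rw [if_neg]
          simp only [Multiset.toFinsupp_apply]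
          omega
      · refine Finset.prod_eq_zero (i := i) (by simpa using hi) ?_
        rw [if_neg]
        tauto

theorem qOdd_eq (n : ℕ) : qOdd n =
    ({l ∈ Nat.Partition.distincts n | ∀ i ∈ l.parts, ¬ Even i} : Finset _).card := by
  unfold qOdd Nat.Partition.oddDistincts Nat.Partition.odds Nat.Partition.restricted
  congr 1
  ext l
  simp [and_comm]

theorem hasProd_qSigned :
    HasProd (fun k : ℕ => (1 - PowerSeries.X ^ (k + 1) : ℤ⟦X⟧)) (PowerSeries.mk qSigned) := by
  convert hasProd_distincts_pow_card (-1 : ℤ) (fun _ => True) using 2 with n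
  · simp [sub_eq_add_neg]
  · simp
    rfl

theorem mk_qSigned : PowerSeries.mk qSigned = PowerSeries.pentagonalSeries ℤ :=
  hasProd_qSigned.unique (PowerSeries.WithPiTopology.hasProd_one_sub_X_pow ℤ)

theorem hasProd_distincts :
    HasProd (fun k : ℕ => (1 + PowerSeries.X ^ (k + 1) : ℤ⟦X⟧))
      (PowerSeries.mk fun n => ((Nat.Partition.distincts n).card : ℤ)) := by
  convert hasProd_distincts_pow_card (1 : ℤ) (fun _ => True) using 2 with n
  · simp
  · simp

/-- The number of odd parts has the parity of their sum. -/
theorem neg_one_pow_card_of_odd_parts {n : ℕ} (l : n.Partition) (h : ∀ i ∈ l.parts, ¬ Even i) :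
    (-1 : ℤ) ^ Multiset.card l.parts = (-1) ^ n := by
  have key : ∀ s : Multiset ℕ, (∀ i ∈ s, ¬ Even i) → (-1 : ℤ) ^ Multiset.card s = (-1) ^ s.sum := by
    intro s
    induction s using Multiset.induction with
    | empty => simp
    | cons a s ih =>
      intro hs
      have ha : Odd a := Nat.not_even_iff_odd.1 (hs a (by simp))
      rw [Multiset.card_cons, Multiset.sum_cons, pow_succ, pow_add, ha.neg_one_pow,
        ih fun i hi => hs i (by simp [hi])]
      ring
  rw [key _ h, l.parts_sum]

theorem hasProd_odd_iff {M : Type*} [CommMonoid M] [TopologicalSpace M] (f : ℕ → M) (x : M) :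
    HasProd (fun i => if ¬ Even (i + 1) then f (i + 1) else 1) x ↔
      HasProd (fun k => f (2 * k + 1)) x := by
  have hinj : Function.Injective fun k : ℕ => 2 * k := fun a b h => by simpa using h
  rw [← hinj.hasProd_iff]
  · simp [Function.comp_def]
  · intro i hi
    rw [if_neg]
    rw [not_not, Nat.even_add_one]
    exact fun ⟨r, hr⟩ => hi ⟨r, by simp only; omega⟩

theorem hasProd_one_sub_X_pow_odd :
    HasProd (fun k : ℕ => (1 - PowerSeries.X ^ (2 * k + 1) : ℤ⟦X⟧))
      (PowerSeries.mk fun n => (-1 : ℤ) ^ n * qOdd n) := by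
  rw [← hasProd_odd_iff fun i => (1 - PowerSeries.X ^ i : ℤ⟦X⟧)]
  convert hasProd_distincts_pow_card (-1 : ℤ) (fun i => ¬ Even i) using 2 with n
  · simp [sub_eq_add_neg]
  · funext n
    rw [Finset.sum_congr rfl fun l hl =>
      neg_one_pow_card_of_odd_parts l (Finset.mem_filter.1 hl).2, Finset.sum_const, ← qOdd_eq]
    simp [mul_comm]

theorem hasProd_one_add_X_pow_odd :
    HasProd (fun k : ℕ => (1 + PowerSeries.X ^ (2 * k + 1) : ℤ⟦X⟧))
      (PowerSeries.mk fun n => (qOdd n : ℤ)) := by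
  rw [← hasProd_odd_iff fun i => (1 + PowerSeries.X ^ i : ℤ⟦X⟧)]
  convert hasProd_distincts_pow_card (1 : ℤ) (fun i => ¬ Even i) using 2 with n
  · simp
  · funext n
    simp [qOdd_eq]

open PowerSeries PowerSeries.WithPiTopology in
theorem one_add_mul_tsum_neg_pow {Y : ℤ⟦X⟧} (hY : constantCoeff Y = 0) :
    (1 + Y) * (1 + ∑' j : ℕ, (-1) ^ (j + 1) * Y ^ (j + 1)) = 1 := by
  have h : constantCoeff (-Y) = 0 := by simp [hY]
  have h1 := one_sub_mul_tsum_pow_of_constantCoeff_eq_zero h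
  rw [(summable_pow_of_constantCoeff_eq_zero h).tsum_eq_zero_add] at h1
  simpa [← mul_pow] using h1

/-- With weight (-1)^c at multiplicity c, each factor is a geometric series in -X^k, which is
identified with the inverse of 1 + X^k by cancellation; the weights of one partition multiply to the
sign of its total number of parts. -/
theorem hasProd_pSigned :
    HasProd (fun k : ℕ => PowerSeries.invOfUnit (1 + PowerSeries.X ^ (k + 1) : ℤ⟦X⟧) 1)
      (PowerSeries.mk pSigned) := by
  convert! Nat.Partition.hasProd_genFun (fun _ c => (-1 : ℤ) ^ c) using 1
  · funext i
    have h1 := PowerSeries.mul_invOfUnit (1 + PowerSeries.X ^ (i + 1) : ℤ⟦X⟧) 1 (by simp)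
    have h2 := one_add_mul_tsum_neg_pow (Y := PowerSeries.X ^ (i + 1)) (by simp)
    have h3 : (1 + PowerSeries.X ^ (i + 1) : ℤ⟦X⟧) ≠ 0 := left_ne_zero_of_mul_eq_one h2
    rw [mul_left_cancel₀ h3 (h1.trans h2.symm)]
    refine congrArg _ (tsum_congr fun j => ?_)
    rw [← pow_mul, PowerSeries.smul_eq_C_mul]
    simp
  · unfold Nat.Partition.genFun
    congr 1
    funext n
    refine Finset.sum_congr rfl fun l _ => ?_
    rw [Finsupp.prod, Finset.prod_pow_eq_pow_sum]
    congr 1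
    rw [Multiset.toFinsupp_support]
    simp

-- Let A = ∏(1+X^k), E = ∏(1-X^k), and let O be the part of E with odd exponents. Then AE =
-- ∏(1-X^(2k)) is the part with even exponents, so O·AE = E. Cancelling E ≠ 0 gives AO = 1, while AP
-- = 1 factor by factor; hence P = O.
open PowerSeries PowerSeries.WithPiTopology in
theorem mk_pSigned :
    PowerSeries.mk pSigned = PowerSeries.mk fun n => (-1 : ℤ) ^ n * qOdd n := by
  have hA := hasProd_distincts
  have hP := hasProd_pSigned
  have hO := hasProd_one_sub_X_pow_odd
  have hE := hasProd_qSigned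
  set A : ℤ⟦X⟧ := PowerSeries.mk fun n => ((Nat.Partition.distincts n).card : ℤ)
  set P := PowerSeries.mk pSigned
  set O : ℤ⟦X⟧ := PowerSeries.mk fun n => (-1 : ℤ) ^ n * qOdd n
  set E := PowerSeries.mk qSigned
  have hE0 : E ≠ 0 := by
    rw [← hE.tprod_eq]
    exact tprod_one_sub_X_pow_ne_zero ℤ
  have hAP : A * P = 1 := by
    refine (hA.mul hP).unique ?_
    convert hasProd_one using 2 with k
    exact PowerSeries.mul_invOfUnit _ 1 (by simp)
  have hAE : HasProd (fun k : ℕ => (1 - X ^ (2 * k + 2) : ℤ⟦X⟧)) (A * E) := by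
    convert hA.mul hE using 2 with k
    ring
  have hOAE : O * (A * E) = E := by
    refine HasProd.unique ?_ hE
    -- Index k carries the exponent k+1, so the even indices form `O`.
    refine HasProd.even_mul_odd (f := fun k => (1 - X ^ (k + 1) : ℤ⟦X⟧)) ?_ ?_
    · exact hO
    · exact hAE
  have hOA : A * O = 1 := by
    refine mul_right_cancel₀ hE0 ?_
    calc A * O * E = O * (A * E) := by ring
      _ = 1 * E := by rw [hOAE, one_mul]
  calc P = (A * O) * P := by rw [hOA, one_mul]
    _ = (A * P) * O := by ring
    _ = O := by rw [hAP, one_mul]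

theorem pSigned_eq (n : ℕ) : pSigned n = (-1 : ℤ) ^ n * qOdd n := by
  simpa using congrArg (PowerSeries.coeff n) mk_pSigned

theorem hasProd_pSigned_odd :
    HasProd (fun k : ℕ => (1 + (-PowerSeries.X) ^ (2 * (k + 1) - 1) : ℤ⟦X⟧))
      (PowerSeries.mk pSigned) := by
  rw [mk_pSigned]
  convert hasProd_one_sub_X_pow_odd using 2 with k
  rw [show 2 * (k + 1) - 1 = 2 * k + 1 by omega, Odd.neg_pow ⟨k, rfl⟩, sub_eq_add_neg]

theorem qOdd_zero : qOdd 0 = 1 := by decide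

theorem hasSum_pSigned :
    HasSum
      (fun j : ℕ => ((-1) ^ (j + 1) * (qOdd (j + 1) : ℤ⟦X⟧) * PowerSeries.X ^ (j + 1) : ℤ⟦X⟧))
      (PowerSeries.mk pSigned - 1) := by
  have h := (PowerSeries.mk pSigned).hasSum_of_monomials_self
  rw [← hasSum_nat_add_iff' 1] at h
  convert! h using 1
  · funext j
    rw [PowerSeries.coeff_mk, pSigned_eq, PowerSeries.monomial_eq_C_mul_X_pow]
    simp
  · simp [pSigned_eq, qOdd_zero]

theorem hasSum_qSigned :
    HasSum
      (fun j : ℕ => ((-1) ^ (j + 1) *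
        (PowerSeries.X ^ ((j + 1) * (3 * (j + 1) - 1) / 2) +
          PowerSeries.X ^ ((j + 1) * (3 * (j + 1) + 1) / 2)) : ℤ⟦X⟧))
      (PowerSeries.mk qSigned - 1) := by
  rw [mk_qSigned]
  -- Pairing k with -k counts the index 0 twice; removing the whole pair at 0 leaves the series
  -- minus 1.
  have h := (PowerSeries.WithPiTopology.hasSum_pentagonalSeries ℤ).nat_add_neg
  rw [← hasSum_nat_add_iff' 1] at h
  convert! h using 1
  · funext j
    have h1 : pentagonal ((j + 1 : ℕ) : ℤ) = (j + 1) * (3 * (j + 1) - 1) / 2 := by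
      have := natCast_pentagonal ((j + 1 : ℕ) : ℤ)
      zify [show 1 ≤ 3 * (j + 1) by omega]
      push_cast at this
      exact this
    have h2 : pentagonal (-((j + 1 : ℕ) : ℤ)) = (j + 1) * (3 * (j + 1) + 1) / 2 := by
      rw [pentagonal_neg]
      norm_cast
    rw [h1, h2, Int.negOnePow_neg]
    have h3 : ((((j + 1 : ℕ) : ℤ).negOnePow : ℤ) : ℤ⟦X⟧) = (-1) ^ (j + 1) := by
      rw [Int.coe_negOnePow_natCast]
      simp
    rw [h3]
    ring
  · have h0 : pentagonal 0 = 0 := rfl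
    simp [h0]

/-! ### A machine for the signed count of partitions into distinct parts -/

namespace SqrtMachine

open StackProg
open Function (update)

/-- The stacks of the machine. -/
inductive Stack
  | inp | mul | dig | rem | root | rem' | root' | diff | bor | res | flag | out
  deriving DecidableEq

instance : Fintype Stack :=
  ⟨{.inp, .mul, .dig, .rem, .root, .rem', .root', .diff, .bor, .res, .flag, .out},
    fun k => by cases k <;> decide⟩

/-- The stack alphabets. -/
abbrev Alphabet : Stack → Type
  | .mul => Fin 24
  | .dig => Fin 4
  | .res => Fin 12
  | _ => Bool

instance : ∀ k, Finite (Alphabet k)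
  | .inp | .rem | .root | .rem' | .root' | .diff | .bor | .flag | .out =>
    inferInstanceAs (Finite Bool)
  | .mul => inferInstanceAs (Finite (Fin 24))
  | .dig => inferInstanceAs (Finite (Fin 4))
  | .res => inferInstanceAs (Finite (Fin 12))

/-- The contents of all stacks. -/
@[simp]
def st (inp : List Bool) (mul : List (Fin 24)) (dig : List (Fin 4))
    (rem root rem' root' diff bor : List Bool) (res : List (Fin 12)) (flag out : List Bool) :
    ∀ k, List (Alphabet k)
  | .inp => inp
  | .mul => mul
  | .dig => dig
  | .rem => rem
  | .root => root
  | .rem' => rem'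
  | .root' => root'
  | .diff => diff
  | .bor => bor
  | .res => res
  | .flag => flag
  | .out => out

section

variable (i : List Bool) (m : List (Fin 24)) (d : List (Fin 4))
    (r q r' q' e b : List Bool) (w : List (Fin 12)) (f o : List Bool)

@[simp] theorem update_inp (x : List Bool) :
    update (st i m d r q r' q' e b w f o) .inp x = st x m d r q r' q' e b w f o := by
  funext k; cases k <;> rfl

@[simp] theorem update_mul (x : List (Fin 24)) :
    update (st i m d r q r' q' e b w f o) .mul x = st i x d r q r' q' e b w f o := by
  funext k; cases k <;> rfl

@[simp] theorem update_dig (x : List (Fin 4)) :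
    update (st i m d r q r' q' e b w f o) .dig x = st i m x r q r' q' e b w f o := by
  funext k; cases k <;> rfl

@[simp] theorem update_rem (x : List Bool) :
    update (st i m d r q r' q' e b w f o) .rem x = st i m d x q r' q' e b w f o := by
  funext k; cases k <;> rfl

@[simp] theorem update_root (x : List Bool) :
    update (st i m d r q r' q' e b w f o) .root x = st i m d r x r' q' e b w f o := by
  funext k; cases k <;> rfl

@[simp] theorem update_rem₂ (x : List Bool) :
    update (st i m d r q r' q' e b w f o) .rem' x = st i m d r q x q' e b w f o := by
  funext k; cases k <;> rfl

@[simp] theorem update_root₂ (x : List Bool) :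
    update (st i m d r q r' q' e b w f o) .root' x = st i m d r q r' x e b w f o := by
  funext k; cases k <;> rfl

@[simp] theorem update_diff (x : List Bool) :
    update (st i m d r q r' q' e b w f o) .diff x = st i m d r q r' q' x b w f o := by
  funext k; cases k <;> rfl

@[simp] theorem update_bor (x : List Bool) :
    update (st i m d r q r' q' e b w f o) .bor x = st i m d r q r' q' e x w f o := by
  funext k; cases k <;> rfl

@[simp] theorem update_res (x : List (Fin 12)) :
    update (st i m d r q r' q' e b w f o) .res x = st i m d r q r' q' e b x f o := by
  funext k; cases k <;> rfl

@[simp] theorem update_flag (x : List Bool) :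
    update (st i m d r q r' q' e b w f o) .flag x = st i m d r q r' q' e b w x o := by
  funext k; cases k <;> rfl

@[simp] theorem update_out (x : List Bool) :
    update (st i m d r q r' q' e b w f o) .out x = st i m d r q r' q' e b w f x := by
  funext k; cases k <;> rfl

end

/-- Push the base-4 digits of `24 n + 1`, where `n` is the input. -/
def readDigits : StackProg Alphabet :=
  push .mul (1 : Fin 24) ;;
  (loop .inp fun b₀ : Bool => case .inp fun b₁ : Option Bool => case .mul fun c : Option (Fin 24) =>
    push .dig (Fin.ofNat 4 (24 * (b₀.toNat + 2 * (b₁.getD false).toNat) + (c.getD 0).val)) ;;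
    push .mul (Fin.ofNat 24 ((24 * (b₀.toNat + 2 * (b₁.getD false).toNat) + (c.getD 0).val) / 4))) ;;
  case .mul fun c : Option (Fin 24) =>
    push .dig (Fin.ofNat 4 (c.getD 0).val) ;;
    push .dig (Fin.ofNat 4 ((c.getD 0).val / 4)) ;;
    push .dig (Fin.ofNat 4 ((c.getD 0).val / 16))

/-- Subtract the number on `root` from the one on `rem`. -/
def subtract : StackProg Alphabet :=
  loop .rem fun r : Bool => case .root fun q : Option Bool => case .bor fun b : Option Bool =>
    push .diff (r ^^ q.getD false ^^ b.getD false) ;;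
    push .bor (bif r then q.getD false && b.getD false else q.getD false || b.getD false) ;;
    push .rem' r ;;
    match q with
    | none => skip
    | some q => push .root' q

/-- Process the next digit in the computation of the integer square root. -/
def sqrtStep (d : Fin 4) : StackProg Alphabet :=
  push .rem (decide (2 ≤ d.val)) ;; push .rem (decide (d.val % 2 = 1)) ;;
  push .root false ;; push .root true ;; push .bor false ;;
  subtract ;;
  pour .root' .root (fun b : Bool => b) ;;
  (case .root fun _ => skip) ;; (case .root fun _ => skip) ;;
  case .bor fun b : Option Bool =>
    bif b.getD false then
      clear .diff ;; pour .rem' .rem (fun b : Bool => b) ;; push .root false ;;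
      case .res fun w : Option (Fin 12) => push .res (2 * w.getD 0)
    else
      clear .rem' ;; pour .diff .rem (fun b : Bool => b) ;; push .root true ;;
      case .res fun w : Option (Fin 12) => push .res (2 * w.getD 0 + 1)

/-- Print the answer. -/
def answer : StackProg Alphabet :=
  (loop .rem fun r : Bool => bif r then push .flag true else skip) ;;
  clear .root ;;
  case .res fun w : Option (Fin 12) => case .flag fun x : Option Bool =>
    clear .flag ;;
    match x with
    | some _ => push .out false
    | none => push .out true ;; push .out (decide (w = some 5 ∨ w = some 7))

/-- The whole program. -/
def prog : StackProg Alphabet :=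
  readDigits ;; push .res (0 : Fin 12) ;; loop .dig sqrtStep ;; answer

/-- Multiplication by 24 with carry, two input bits per base-4 digit. The carry stays below 24
because (24·3 + 23)/4 < 24, and an absent second bit counts as 0. Digits are pushed least
significant first, so the stack reads from the most significant one and its value is a left fold
that starts from the carry. -/
theorem runs_readDigits_loop (l : List Bool) (c : Fin 24) (M : List (Fin 4)) :
    ∃ (c' : Fin 24) (M' : List (Fin 4)),
      M'.foldl (fun u d => 4 * u + d.val) c'.val =
        M.foldl (fun u d => 4 * u + d.val) (24 * bitsVal l + c.val) ∧
      M'.length ≤ M.length + l.length ∧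
      Runs (loop .inp fun b₀ : Bool => case .inp fun b₁ : Option Bool =>
        case .mul fun c : Option (Fin 24) =>
        push .dig (Fin.ofNat 4 (24 * (b₀.toNat + 2 * (b₁.getD false).toNat) + (c.getD 0).val)) ;;
        push .mul
          (Fin.ofNat 24 ((24 * (b₀.toNat + 2 * (b₁.getD false).toNat) + (c.getD 0).val) / 4)))
        (st l [c] M [] [] [] [] [] [] [] [] []) (st [] [c'] M' [] [] [] [] [] [] [] [] [])
        (5 * l.length + 1) := by
  induction l using List.twoStepInduction generalizing c M with
  | nil => exact ⟨c, M, by simp [bitsVal], by simp, runs_loop_nil rfl⟩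
  | singleton b₀ =>
    refine ⟨Fin.ofNat 24 ((24 * b₀.toNat + c.val) / 4),
      Fin.ofNat 4 (24 * b₀.toNat + c.val) :: M, ?_, ?_, ?_⟩
    rotate_left 2
    · apply Runs.conv
      · exact .loop_cons (a := b₀) (l := []) rfl
          (.case (.case (.seq (runs_push _ _ _) (runs_push _ _ _)))) (runs_loop_nil (by simp))
      · simp
      · simp
    · have hb := b₀.toNat_le
      have hc := c.isLt
      simp [bitsVal, Fin.ofNat]
      congr 1
      omega
    · simp
  | cons_cons b₀ b₁ l ih _ =>
    have hb := b₀.toNat_le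
    have hb' := b₁.toNat_le
    have hc := c.isLt
    obtain ⟨c', M', h, hl, hr⟩ := ih
      (Fin.ofNat 24 ((24 * (b₀.toNat + 2 * b₁.toNat) + c.val) / 4))
      (Fin.ofNat 4 (24 * (b₀.toNat + 2 * b₁.toNat) + c.val) :: M)
    refine ⟨c', M', ?_, ?_, ?_⟩
    · rw [h]
      simp [bitsVal, Fin.ofNat]
      congr 1
      omega
    · simp at hl ⊢
      omega
    · refine Runs.mono (.loop_cons (a := b₀) (l := b₁ :: l) (T₂ := 5 * l.length + 1) rfl
        (.case (.case (.seq (runs_push _ _ _) (runs_push _ _ _)))) ?_) ?_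
      · simpa using hr
      · simp
        omega

theorem runs_readDigits (l : List Bool) :
    ∃ M : List (Fin 4), M.foldl (fun u d => 4 * u + d.val) 0 = 24 * bitsVal l + 1 ∧
      M.length ≤ l.length + 3 ∧
      Runs readDigits (st l [] [] [] [] [] [] [] [] [] [] [])
        (st [] [] M [] [] [] [] [] [] [] [] []) (5 * l.length + 6) := by
  -- The initial carry 1 is the summand in 24n + 1. The final carry, below 24, is flushed as three
  -- base-4 digits.
  obtain ⟨c, M, h, hl, hr⟩ := runs_readDigits_loop l 1 []
  refine ⟨Fin.ofNat 4 (c.val / 16) :: Fin.ofNat 4 (c.val / 4) :: Fin.ofNat 4 c.val :: M,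
    ?_, ?_, ?_⟩
  · have hc := c.isLt
    simp only [List.foldl_nil, Fin.val_one] at h
    rw [← h]
    simp [Fin.ofNat]
    congr 1
    omega
  · simpa using hl
  · apply Runs.conv
    · apply Runs.push_seq
      simp only [st, update_mul]
      apply hr.seq; apply Runs.case
      simp only [st, update_mul]
      apply Runs.push_seq
      simp only [st, update_dig]
      apply Runs.push_seq
      simp only [st, update_dig]
      exact runs_push _ _ _
    · simp
    · omega

/-- Binary subtraction with borrow. The final borrow `b₁` decides the comparison, and both operands
survive reversed, so that the subtraction can be undone. The length hypothesis ensures that `root`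
is exhausted when `rem` is. -/
theorem runs_subtract {i : List Bool} {m : List (Fin 24)} {d : List (Fin 4)}
    {w : List (Fin 12)} {f o : List Bool} (r : List Bool) :
    ∀ (q r' q' e : List Bool) (b : Bool), q.length ≤ r.length →
    ∃ (e₁ : List Bool) (b₁ : Bool), e₁.length = r.length ∧
      bitsVal e₁ + bitsVal q + b.toNat = bitsVal r + 2 ^ r.length * b₁.toNat ∧
      Runs subtract (st i m d r q r' q' e [b] w f o)
        (st i m d [] [] (r.reverse ++ r') (q.reverse ++ q') (e₁.reverse ++ e) [b₁] w f o)
        (7 * r.length + 1) := by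
  induction r with
  | nil =>
    intro q r' q' e b hq
    obtain rfl : q = [] := by simpa using hq
    refine ⟨[], b, rfl, by simp [bitsVal], runs_loop_nil rfl⟩
  | cons a r ih =>
    intro q r' q' e b hq
    obtain ⟨e₁, b₁, hl, hv, hr⟩ := ih q.tail (a :: r') (q.head?.toList ++ q')
      ((a ^^ q.head?.getD false ^^ b) :: e)
      (bif a then q.head?.getD false && b else q.head?.getD false || b) (by simp at hq ⊢; omega)
    refine ⟨(a ^^ q.head?.getD false ^^ b) :: e₁, b₁, by simp [hl], ?_, ?_⟩
    · have hq2 : bitsVal q = (q.head?.getD false).toNat + 2 * bitsVal q.tail := by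
        cases q <;> simp [bitsVal]
      rw [bitsVal, bitsVal, hq2, List.length_cons, pow_succ]
      generalize q.head?.getD false = x at hv ⊢
      generalize 2 ^ r.length = y at hv ⊢
      cases a <;> cases b <;> cases x <;> cases b₁ <;> simp at hv ⊢ <;> omega
    · unfold subtract at hr ⊢
      apply Runs.conv
      · refine .loop_cons (a := a) (l := r) (T₁ := 6) rfl ?_ hr
        refine Runs.case (T := 5) (.case (T := 4) ?_)
        refine Runs.push_seq (T := 3) (.push_seq (T := 2) (.push_seq (T := 1) ?_))
        cases q with
        | nil =>
          simp
          exact runs_skip _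
        | cons x q =>
          simp
          apply Runs.conv
          · exact runs_push _ _ _
          · simp
          · exact le_rfl
      · cases q <;> simp
      · simp; omega

/-- If r + q² is the value of the digits read so far, the next root is 2q + 1 exactly when 4r + a ≥
4q + 1, and the difference is then the new remainder; otherwise the root is 2q and 4r + a remains.
The bound r ≤ 2q says that q is the integer part of the root. The root modulo 12 is updated
alongside. -/
theorem runs_sqrtStep {d : List (Fin 4)} (a : Fin 4) (r q : List Bool) (w : Fin 12)
    (hq : q.length ≤ r.length) (hw : w.val = bitsVal q % 12)
    (hr : bitsVal r ≤ 2 * bitsVal q) :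
    ∃ (r₁ q₁ : List Bool) (w₁ : Fin 12), r₁.length = r.length + 2 ∧
      q₁.length = q.length + 1 ∧ w₁.val = bitsVal q₁ % 12 ∧ bitsVal r₁ ≤ 2 * bitsVal q₁ ∧
      bitsVal r₁ + bitsVal q₁ ^ 2 = 4 * (bitsVal r + bitsVal q ^ 2) + a.val ∧
      Runs (sqrtStep a) (st [] [] d r q [] [] [] [] [w] [] [])
        (st [] [] d r₁ q₁ [] [] [] [] [w₁] [] []) (13 * r.length + 50) := by
  set r₀ : List Bool := decide (a.val % 2 = 1) :: decide (2 ≤ a.val) :: r with hr₀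
  set q₀ : List Bool := true :: false :: q with hq₀
  obtain ⟨e, b, he, hv, hs⟩ := runs_subtract (i := []) (m := []) (d := d) (w := [w]) (f := [])
    (o := []) r₀ q₀ [] [] [] false (by simpa [hr₀, hq₀] using hq)
  have ha := a.isLt
  have hr₀v : bitsVal r₀ = 4 * bitsVal r + a.val := by
    simp only [hr₀, bitsVal]
    by_cases h₁ : a.val % 2 = 1 <;> by_cases h₂ : 2 ≤ a.val <;> simp [h₁, h₂] <;> omega
  have hq₀v : bitsVal q₀ = 4 * bitsVal q + 1 := by
    simp only [hq₀, bitsVal, Bool.toNat_true, Bool.toNat_false]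
    omega
  have hlt := bitsVal_lt e
  have hlt' := bitsVal_lt r₀
  rw [he] at hlt
  rw [hr₀v, hq₀v] at hv
  -- Both outcomes share the execution up to the test of the borrow. The two low digits `true`,
  -- `false` that make 4q + 1 are popped again there.
  have key : ∀ (r₁ : List Bool) (q₁ : List Bool) (w₁ : Fin 12),
      Runs (bif b then
        clear .diff ;; pour .rem' .rem (fun b : Bool => b) ;; push .root false ;;
        case .res fun w : Option (Fin 12) => push .res (2 * w.getD 0)
      else
        clear .rem' ;; pour .diff .rem (fun b : Bool => b) ;; push .root true ;;
        case .res fun w : Option (Fin 12) => push .res (2 * w.getD 0 + 1))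
        (st [] [] d [] q r₀.reverse [] e.reverse [] [w] [] [])
        (st [] [] d r₁ q₁ [] [] [] [] [w₁] [] []) (4 * r₀.length + 6) →
      Runs (sqrtStep a) (st [] [] d r q [] [] [] [] [w] [] [])
        (st [] [] d r₁ q₁ [] [] [] [] [w₁] [] []) (13 * r.length + 50) := by
    intro r₁ q₁ w₁ h
    apply Runs.mono
    · unfold sqrtStep
      apply Runs.push_seq
      simp only [st, update_rem]
      apply Runs.push_seq
      simp only [st, update_rem]
      apply Runs.push_seq
      simp only [st, update_root]
      apply Runs.push_seq
      simp only [st, update_root]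
      apply Runs.push_seq
      simp only [st, update_bor]
      apply hs.seq
      apply Runs.pour_seq (by decide)
      simp only [st, update_root₂, update_root, List.map_id', List.reverse_reverse, List.append_nil]
      apply Runs.case_seq
      apply Runs.skip_seq
      simp only [st, update_root, hq₀, List.tail_cons]
      apply Runs.case_seq
      apply Runs.skip_seq
      simp only [st, update_root, List.tail_cons]
      apply Runs.case
      simp only [st, update_bor, List.head?_cons, Option.getD_some, List.tail_cons]
      exact h
    · simp [hr₀, hq₀]
      omega
  cases b with
  | true =>
    refine ⟨r₀, false :: q, 2 * w, by simp [hr₀], by simp, ?_, ?_, ?_, key _ _ _ ?_⟩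
    · simp only [bitsVal, Fin.val_mul, hw, Bool.toNat_false]
      simp
    · simp only [bitsVal, Bool.toNat_true, Bool.toNat_false, hr₀v] at hv ⊢
      omega
    · rw [hr₀v, bitsVal, Bool.toNat_false]
      ring
    · apply Runs.conv
      · rw [cond_true]
        apply Runs.clear_seq
        simp only [update_diff]
        apply Runs.pour_seq (by decide)
        simp only [st, update_rem, update_rem₂]
        apply Runs.push_seq
        simp only [st, update_root]
        apply Runs.case
        simp only [st, update_res]
        exact runs_push _ _ _
      · simp
      · simp [he]
        omega
  | false =>
    refine ⟨e, true :: q, 2 * w + 1, by simp [he, hr₀], by simp, ?_, ?_, ?_, key _ _ _ ?_⟩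
    · simp only [bitsVal, Fin.val_mul, Fin.val_add, hw, Bool.toNat_true]
      simp
      omega
    · simp only [bitsVal, Bool.toNat_true, Bool.toNat_false] at hv ⊢
      omega
    · simp only [bitsVal, Bool.toNat_true, Bool.toNat_false] at hv ⊢
      have : bitsVal e + (4 * bitsVal q + 1) = 4 * bitsVal r + a.val := by omega
      linear_combination this
    · apply Runs.conv
      · rw [cond_false]
        apply Runs.clear_seq
        simp only [update_rem₂]
        apply Runs.pour_seq (by decide)
        simp only [st, update_rem, update_diff]
        apply Runs.push_seq
        simp only [st, update_root]
        apply Runs.case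
        simp only [st, update_res]
        exact runs_push _ _ _
      · simp
      · simp [he]
        omega

theorem runs_sqrt_loop (M : List (Fin 4)) : ∀ (N : ℕ) (r q : List Bool) (w : Fin 12),
    q.length ≤ r.length → w.val = bitsVal q % 12 → bitsVal r ≤ 2 * bitsVal q →
    r.length + 2 * M.length ≤ N →
    ∃ (r₁ q₁ : List Bool) (w₁ : Fin 12), r₁.length ≤ N ∧ q₁.length ≤ r₁.length ∧
      w₁.val = bitsVal q₁ % 12 ∧ bitsVal r₁ ≤ 2 * bitsVal q₁ ∧
      bitsVal r₁ + bitsVal q₁ ^ 2 =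
        M.foldl (fun u d => 4 * u + d.val) (bitsVal r + bitsVal q ^ 2) ∧
      Runs (loop .dig sqrtStep) (st [] [] M r q [] [] [] [] [w] [] [])
        (st [] [] [] r₁ q₁ [] [] [] [] [w₁] [] []) (M.length * (13 * N + 51) + 1) := by
  induction M with
  | nil =>
    intro N r q w hq hw hr hN
    exact ⟨r, q, w, by simpa using hN, hq, hw, hr, rfl, (runs_loop_nil rfl).mono (by simp)⟩
  | cons a M ih =>
    intro N r q w hq hw hr hN
    rw [List.length_cons] at hN
    obtain ⟨r₁, q₁, w₁, hr₁, hq₁, hw₁, hr', hv, hs⟩ := runs_sqrtStep (d := M) a r q w hq hw hr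
    obtain ⟨r₂, q₂, w₂, h₁, h₂, h₃, h₄, h₅, h₆⟩ := ih N r₁ q₁ w₁ (by omega) hw₁ hr' (by omega)
    refine ⟨r₂, q₂, w₂, h₁, h₂, h₃, h₄, ?_, ?_⟩
    · rw [h₅, hv, List.foldl_cons]
    · apply Runs.mono
      · exact Runs.loop_cons (s₁ := st [] [] (a :: M) r q [] [] [] [] [w] [] []) rfl
          (by simpa using hs) h₆
      · rw [List.length_cons]
        nlinarith

/-- The stack `flag` receives one mark per nonzero bit of the remainder, so it is empty exactly for
a perfect square. The lists printed are the codes of -1, 1 and 0. -/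
theorem runs_answer (r q : List Bool) (w : Fin 12) :
    Runs answer (st [] [] [] r q [] [] [] [] [w] [] [])
      (st [] [] [] [] [] [] [] [] [] [] []
        (if bitsVal r = 0 then [decide (w = 5 ∨ w = 7), true] else [false]))
      (5 * r.length + 2 * q.length + 10) := by
  have hloop : Runs (loop .rem fun r : Bool => bif r then push .flag true else skip)
      (st [] [] [] r q [] [] [] [] [w] [] [])
      (st [] [] [] [] q [] [] [] [] [w] (List.replicate (r.count true) true) [])
      (r.length * (1 + 1) + 1) := by
    have := runs_loop_foldl (Γ := Alphabet) (k := .rem)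
      (f := fun r : Bool => bif r then push .flag true else skip)
      (fun (x : List Bool) (b : Bool) => bif b then true :: x else x)
      (fun x l => st [] [] [] l q [] [] [] [] [w] x []) (fun _ _ => True) 1 (fun _ _ => rfl)
      (fun x b l _ => ⟨trivial, ?_⟩) r [] trivial
    · convert this using 2
      suffices h : ∀ n, r.foldl (fun (x : List Bool) (b : Bool) => bif b then true :: x else x)
          (List.replicate n true) = List.replicate (n + r.count true) true by
        simpa using (h 0).symm
      clear this
      induction r with
      | nil => simp
      | cons b r ih =>
        intro n
        cases b
        · simpa using ih n
        · simpa [List.replicate_succ, add_assoc, add_comm 1] using ih (n + 1)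
    · cases b
      · simpa using runs_skip _
      · simpa using runs_push (Γ := Alphabet) .flag true (st [] [] [] l q [] [] [] [] [w] x [])
  have hcount : r.count true = 0 ↔ bitsVal r = 0 := by
    rw [List.count_eq_zero, bitsVal_eq_zero_iff]
    refine ⟨fun h b hb => ?_, fun h hb => by simpa using h _ hb⟩
    cases b
    · rfl
    · exact absurd hb h
  have hle : r.count true ≤ r.length := List.count_le_length
  cases hc : r.count true with
  | zero =>
    rw [if_pos (hcount.1 hc)]
    rw [hc] at hloop
    apply Runs.conv
    · apply hloop.seq
      apply Runs.clear_seq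
      simp only [update_root]
      apply Runs.case
      apply Runs.case
      simp only [st, update_res, update_flag, List.replicate_zero, List.head?_nil, List.tail_nil]
      apply Runs.clear_seq
      apply Runs.push_seq
      exact runs_push _ _ _
    · simp
    · simp
      omega
  | succ n =>
    rw [if_neg (by omega)]
    rw [hc] at hloop
    apply Runs.conv
    · apply hloop.seq
      apply Runs.clear_seq
      simp only [update_root]
      apply Runs.case
      apply Runs.case
      simp only [st, update_res, update_flag, List.replicate_succ, List.head?_cons, List.tail_cons]
      apply Runs.clear_seq
      exact runs_push _ _ _
    · simp
    · simp
      omega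

theorem runs_prog (l : List Bool) :
    ∃ r m : ℕ, r ≤ 2 * m ∧ r + m ^ 2 = 24 * bitsVal l + 1 ∧
      Runs prog (st l [] [] [] [] [] [] [] [] [] [] [])
        (st [] [] [] [] [] [] [] [] [] [] []
          (if r = 0 then [decide (m % 12 = 5 ∨ m % 12 = 7), true] else [false]))
        (500 * (l.length + 1) ^ 2) := by
  obtain ⟨M, hM, hMl, h₁⟩ := runs_readDigits l
  obtain ⟨r, q, w, hr, hq, hw, hle, hv, h₂⟩ := runs_sqrt_loop M (2 * M.length) [] [] 0 (by simp)
    (by simp [bitsVal]) (by simp [bitsVal]) (by simp)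
  refine ⟨bitsVal r, bitsVal q, hle, ?_, ?_⟩
  · rw [hv, ← hM]
    simp [bitsVal]
  · apply Runs.conv
    · apply h₁.seq
      apply Runs.push_seq
      simp only [st, update_res]
      apply h₂.seq
      exact runs_answer r q w
    · have h5 : w = 5 ↔ bitsVal q % 12 = 5 := by rw [← hw, Fin.ext_iff]; rfl
      have h7 : w = 7 ↔ bitsVal q % 12 = 7 := by rw [← hw, Fin.ext_iff]; rfl
      simp only [h5, h7]
    · nlinarith

theorem st_nil : (fun _ => []) = st [] [] [] [] [] [] [] [] [] [] [] [] := by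
  funext k; cases k <;> rfl

end SqrtMachine

/-! ### The signed count of partitions into distinct parts is computable in polynomial time -/

theorem qSigned_eq_coeff (n : ℕ) :
    qSigned n = (PowerSeries.pentagonalSeries ℤ).coeff n := by
  rw [← mk_qSigned, PowerSeries.coeff_mk]

theorem twentyfour_mul_pentagonal_add_one (k : ℤ) :
    24 * (pentagonal k : ℤ) + 1 = (6 * k - 1) ^ 2 := by
  linear_combination 12 * two_mul_natCast_pentagonal k

/-- Here n is the pentagonal number of index k with m = |6k - 1|, and k is odd exactly when m is 5
or 7 modulo 12. -/
theorem qSigned_of_sq {n m : ℕ} (h : m ^ 2 = 24 * n + 1) :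
    qSigned n = if m % 12 = 5 ∨ m % 12 = 7 then -1 else 1 := by
  have key : ∀ k : ℤ, (6 * k - 1) ^ 2 = (m : ℤ) ^ 2 → qSigned n = (k.negOnePow : ℤ) := by
    intro k hk
    have h1 : pentagonal k = n := by
      have := twentyfour_mul_pentagonal_add_one k
      zify at h ⊢
      omega
    rw [qSigned_eq_coeff, ← h1, PowerSeries.coeff_pentagonalSeries_pentagonal]
    rfl
  have hm : (m % 24) ^ 2 % 24 = 1 := by
    rw [← Nat.pow_mod, h]
    omega
  obtain ⟨j, hj⟩ : ∃ j, m = 24 * j + m % 24 := ⟨m / 24, by omega⟩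
  have hlt : m % 24 < 24 := Nat.mod_lt _ (by norm_num)
  generalize m % 24 = r at hm hj hlt
  subst hj
  -- The eight units modulo 24 remain; each determines k in terms of j.
  interval_cases r <;> simp at hm
  · rw [key (-(4 * j)) (by push_cast; ring), if_neg (by omega),
      Int.negOnePow_even _ ⟨-(2 * j), by ring⟩]
    rfl
  · rw [key (4 * j + 1) (by push_cast; ring), if_pos (by omega),
      Int.negOnePow_odd _ ⟨2 * j, by ring⟩]
    rfl
  · rw [key (-(4 * j + 1)) (by push_cast; ring), if_pos (by omega),
      Int.negOnePow_odd _ ⟨-(2 * j) - 1, by ring⟩]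
    rfl
  · rw [key (4 * j + 2) (by push_cast; ring), if_neg (by omega),
      Int.negOnePow_even _ ⟨2 * j + 1, by ring⟩]
    rfl
  · rw [key (-(4 * j + 2)) (by push_cast; ring), if_neg (by omega),
      Int.negOnePow_even _ ⟨-(2 * j) - 1, by ring⟩]
    rfl
  · rw [key (4 * j + 3) (by push_cast; ring), if_pos (by omega),
      Int.negOnePow_odd _ ⟨2 * j + 1, by ring⟩]
    rfl
  · rw [key (-(4 * j + 3)) (by push_cast; ring), if_pos (by omega),
      Int.negOnePow_odd _ ⟨-(2 * j) - 2, by ring⟩]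
    rfl
  · rw [key (4 * j + 4) (by push_cast; ring), if_neg (by omega),
      Int.negOnePow_even _ ⟨2 * j + 2, by ring⟩]
    rfl

/-- The bounds place 24n + 1 strictly between m² and (m+1)², so it is not a square and n is not
pentagonal. -/
theorem qSigned_eq_zero {n r m : ℕ} (h : r + m ^ 2 = 24 * n + 1) (h0 : r ≠ 0) (hr : r ≤ 2 * m) :
    qSigned n = 0 := by
  rw [qSigned_eq_coeff]
  refine PowerSeries.coeff_pentagonalSeries_eq_zero ℤ ?_
  rintro ⟨k, rfl⟩
  have h1 := twentyfour_mul_pentagonal_add_one k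
  have h2 : r + m ^ 2 = (6 * k - 1).natAbs ^ 2 := by
    zify
    rw [sq_abs, ← h1]
    exact_mod_cast h
  have h3 : m < (6 * k - 1).natAbs := lt_of_pow_lt_pow_left' 2 (by omega)
  have h4 : (6 * k - 1).natAbs < m + 1 := lt_of_pow_lt_pow_left' 2 (by nlinarith)
  omega

theorem log_two_add_ge (n : ℕ) : 1 / 2 ≤ Real.log (2 + (n : ℝ)) :=
  (Real.log_two_gt_d9.le.trans' (by norm_num)).trans
    (Real.log_le_log (by norm_num) (by simp))

theorem length_encodeNat_le (n : ℕ) :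
    ((Computability.encodeNat n).length : ℝ) ≤ 4 * Real.log (2 + (n : ℝ)) := by
  have h1 : ((2 : ℝ)) ^ (Computability.encodeNat n).length ≤ (2 + n) ^ 2 := by
    have : ((2 : ℝ)) ^ (Computability.encodeNat n).length ≤ 2 * n + 1 := by
      exact_mod_cast two_pow_length_encodeNat_le n
    nlinarith
  have h2 := Real.log_le_log (by positivity) h1
  rw [Real.log_pow, Real.log_pow] at h2
  have h3 := Real.log_two_gt_d9
  have h4 : (0 : ℝ) ≤ (Computability.encodeNat n).length := by positivity
  push_cast at h2
  nlinarith

theorem computableWithin_qSigned :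
    ComputableWithin qSigned (fun n => ((20000 : ℕ) : ℝ) * Real.log (2 + (n : ℝ)) ^ 2) := by
  refine .of_runs SqrtMachine.prog .inp .out (Equiv.refl _) (Equiv.refl _) fun n => ?_
  obtain ⟨r, m, hr, hm, h⟩ := SqrtMachine.runs_prog (Computability.encodeNat n)
  refine ⟨500 * ((Computability.encodeNat n).length + 1) ^ 2, ?_, ?_⟩
  -- With L = log(2+n) ≥ 1/2, the length plus one is at most 6L, so the time is at most 18000 L² + 1
  -- ≤ 20000 L².
  · have h1 := length_encodeNat_le n
    have h2 := log_two_add_ge n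
    push_cast
    nlinarith
  · rw [bitsVal_encodeNat] at hm
    rw [SqrtMachine.st_nil, SqrtMachine.update_inp, SqrtMachine.update_out]
    convert h using 2
    · exact List.map_id _
    · rw [Equiv.refl_symm, Equiv.coe_refl, List.map_id]
      split_ifs with h0
      · rw [h0, zero_add] at hm
        rw [qSigned_of_sq hm]
        split_ifs with h1 <;> simp [h1] <;> rfl
      · rw [qSigned_eq_zero hm h0 hr]
        rfl

theorem log_two_add_le_inOutSize (f : ℕ → ℤ) (n : ℕ) :
    Real.log (2 + (n : ℝ)) ≤ inOutSize f n := by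
  have h1 : Real.log 2 ≤ Real.log (2 + |(f n : ℝ)|) :=
    Real.log_le_log (by norm_num) (by simp)
  have h2 : Real.log (2 + (n : ℝ)) ≤ Real.log ((1 + n) * 2) :=
    Real.log_le_log (by positivity) (by linarith [(Nat.cast_nonneg n : (0 : ℝ) ≤ n)])
  rw [Real.log_mul (by positivity) (by norm_num)] at h2
  unfold inOutSize
  linarith

theorem ComputableWithin.mono {f : ℕ → ℤ} {T T' : ℕ → ℝ} (h : ComputableWithin f T)
    (hT : ∀ n, T n ≤ T' n) : ComputableWithin f T' := by
  obtain ⟨M, hM, h⟩ := h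
  refine ⟨M, hM, fun n => ?_⟩
  obtain ⟨t, ht, h⟩ := h n
  exact ⟨t, ht.trans (hT n), h⟩

theorem isPIO_qSigned : IsPIO qSigned := by
  refine ⟨20000, 2, by norm_num, by norm_num, computableWithin_qSigned.mono fun n => ?_⟩
  have h1 := log_two_add_le_inOutSize qSigned n
  have h2 := log_two_add_ge n
  gcongr

/-! ### A machine for the signed count of all partitions -/

namespace StackProg

open Function (update)

variable {K : Type} [DecidableEq K]

/-- Push the image of the stack `i` on the stack `j`, with the help of the empty stack `t`. -/
def copy (i j t : K) (f : Bool → Bool) : StackProg (fun _ : K => Bool) :=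
  (loop i fun a => push j (f a) ;; push t a) ;; pour t i id

theorem runs_copy {i j t : K} (hij : i ≠ j) (hit : i ≠ t) (hjt : j ≠ t) (f : Bool → Bool)
    (s : K → List Bool) (ht : s t = []) :
    Runs (copy i j t f) s (update s j (((s i).map f).reverse ++ s j))
      (5 * (s i).length + 2) := by
  have h := runs_loop_foldl (Γ := fun _ : K => Bool) (k := i)
    (f := fun a => push j (f a) ;; push t a)
    (fun (x : List Bool × List Bool) a => (f a :: x.1, a :: x.2))
    (fun x l => update (update (update s i l) j x.1) t x.2) (fun _ _ => True) 2
    (fun x l => by simp [hij, hit])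
    (fun x a l _ => ⟨trivial, ?_⟩) (s i) (s j, []) trivial
  · have hfold : ∀ (l : List Bool) x, l.foldl (fun (x : List Bool × List Bool) a => (f a :: x.1, a :: x.2)) x =
        ((l.map f).reverse ++ x.1, l.reverse ++ x.2) := by
      intro l
      induction l with
      | nil => simp
      | cons a l ih => intro x; simp [ih]
    have hs : update (update (update s i (s i)) j (s j)) t [] = s := by
      rw [← ht]
      simp
    rw [hfold, hs] at h
    apply Runs.conv
    · exact h.seq (runs_pour (Γ := fun _ : K => Bool) hit.symm id _)
    · funext k
      simp only [Function.update_apply]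
      split_ifs <;> simp_all
    · simp
      omega
  · apply Runs.conv
    · apply Runs.push_seq
      exact runs_push _ _ _
    · funext k
      simp only [Function.update_apply]
      split_ifs <;> simp_all
    · exact le_rfl

theorem Runs.copy_seq {i j t : K} {f : Bool → Bool} {s s' : K → List Bool}
    {q : StackProg (fun _ : K => Bool)} {T : ℕ} (ht : s t = []) (hij : i ≠ j)
    (hit : i ≠ t) (hjt : j ≠ t)
    (h : Runs q (update s j (((s i).map f).reverse ++ s j)) s' T) :
    Runs (copy i j t f ;; q) s s' (5 * (s i).length + 2 + T) :=
  (runs_copy hij hit hjt f s ht).seq h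

end StackProg

namespace DigitMachine

open StackProg
open Function (update)

/-- The stacks of the machine. -/
inductive Stack
  | inp | sgn | rv | cnt | len | tmp | acc | buf | shf | sum | off | aux | car
  deriving DecidableEq

instance : Fintype Stack :=
  ⟨{.inp, .sgn, .rv, .cnt, .len, .tmp, .acc, .buf, .shf, .sum, .off, .aux, .car},
    fun k => by cases k <;> decide⟩

/-- The contents of all stacks. -/
@[simp]
def st (inp sgn rv cnt len tmp acc buf shf sum off aux car : List Bool) : Stack → List Bool
  | .inp => inp
  | .sgn => sgn
  | .rv => rv
  | .cnt => cnt
  | .len => len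
  | .tmp => tmp
  | .acc => acc
  | .buf => buf
  | .shf => shf
  | .sum => sum
  | .off => off
  | .aux => aux
  | .car => car

section

variable (i g r u v t a b d e s z c x : List Bool)

@[simp] theorem update_inp :
    update (st i g r u v t a b d e s z c) .inp x = st x g r u v t a b d e s z c := by
  funext k; cases k <;> rfl

@[simp] theorem update_sgn :
    update (st i g r u v t a b d e s z c) .sgn x = st i x r u v t a b d e s z c := by
  funext k; cases k <;> rfl

@[simp] theorem update_rv :
    update (st i g r u v t a b d e s z c) .rv x = st i g x u v t a b d e s z c := by
  funext k; cases k <;> rfl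

@[simp] theorem update_cnt :
    update (st i g r u v t a b d e s z c) .cnt x = st i g r x v t a b d e s z c := by
  funext k; cases k <;> rfl

@[simp] theorem update_len :
    update (st i g r u v t a b d e s z c) .len x = st i g r u x t a b d e s z c := by
  funext k; cases k <;> rfl

@[simp] theorem update_acc :
    update (st i g r u v t a b d e s z c) .acc x = st i g r u v t x b d e s z c := by
  funext k; cases k <;> rfl

@[simp] theorem update_buf :
    update (st i g r u v t a b d e s z c) .buf x = st i g r u v t a x d e s z c := by
  funext k; cases k <;> rfl

@[simp] theorem update_shf :
    update (st i g r u v t a b d e s z c) .shf x = st i g r u v t a b x e s z c := by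
  funext k; cases k <;> rfl

@[simp] theorem update_sum :
    update (st i g r u v t a b d e s z c) .sum x = st i g r u v t a b d x s z c := by
  funext k; cases k <;> rfl

@[simp] theorem update_off :
    update (st i g r u v t a b d e s z c) .off x = st i g r u v t a b d e x z c := by
  funext k; cases k <;> rfl

@[simp] theorem update_aux :
    update (st i g r u v t a b d e s z c) .aux x = st i g r u v t a b d e s x c := by
  funext k; cases k <;> rfl

@[simp] theorem update_car :
    update (st i g r u v t a b d e s z c) .car x = st i g r u v t a b d e s z x := by
  funext k; cases k <;> rfl

theorem st_nil : (fun _ => []) = st [] [] [] [] [] [] [] [] [] [] [] [] [] := by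
  funext k; cases k <;> rfl

end

/-- Programs over binary stacks. -/
abbrev Prog := StackProg fun _ : Stack => Bool

/-- Save the parity of the input and reverse it. -/
def readInput : Prog :=
  (case .inp fun b => push .sgn (b.getD false) ;;
    match b with
    | none => skip
    | some b => push .inp b) ;;
  pour .inp .rv id

/-- Write the input in unary. -/
def unary : Prog :=
  loop .rv fun b => copy .cnt .aux .tmp id ;; pour .aux .cnt id ;;
    bif b then push .cnt true else skip

/-- Prepare the number `1` on `acc`, and the counters. -/
def prepare : Prog :=
  copy .cnt .len .tmp id ;; push .len true ;; copy .len .off .tmp id ;;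
  (loop .cnt fun _ => copy .len .acc .tmp (fun _ => false) ;; push .aux true) ;;
  pour .aux .cnt id ;; copy .len .acc .tmp (fun _ => false) ;;
  (case .acc fun _ => skip) ;; push .acc true

/-- Add the number on `shf` to the one on `acc`, with the reversed result on `sum`. -/
def addLoop : Prog :=
  loop .acc fun a => case .shf fun d => case .car fun c =>
    push .sum (a ^^ d.getD false ^^ c.getD false) ;;
    push .car (bif a then d.getD false || c.getD false else d.getD false && c.getD false)

/-- Add to the number on `acc` its shift by the length of `off`. -/
def shiftAdd : Prog :=
  pour .acc .buf id ;; copy .buf .shf .tmp id ;; pour .buf .acc id ;;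
  copy .off .shf .aux (fun _ => false) ;; push .car false ;; addLoop ;;
  clear .car ;; clear .shf ;; pour .sum .acc id

/-- Extract the leading digit of `acc`. -/
def extract : Prog :=
  pour .acc .sum id ;;
  loop .len fun _ => case .sum fun b =>
    bif b.getD false then push .acc true
    else case .acc fun a =>
      match a with
      | none => skip
      | some a => push .acc a ;; push .acc false

/-- The whole program. -/
def prog : Prog :=
  readInput ;; unary ;; prepare ;;
  (loop .cnt fun _ => shiftAdd ;; copy .len .off .tmp id ;; copy .len .off .tmp id) ;;
  extract ;; (case .sgn fun b => push .acc (b.getD false)) ;; clear .off ;; clear .sum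

theorem runs_readInput (l : List Bool) :
    Runs readInput (st l [] [] [] [] [] [] [] [] [] [] [] [])
      (st [] [l.head?.getD false] l.reverse [] [] [] [] [] [] [] [] [] [])
      (2 * l.length + 4) := by
  cases l with
  | nil =>
    apply Runs.conv
    · apply Runs.case_seq
      simp only [st, update_inp, List.head?_nil]
      apply Runs.assoc
      apply Runs.push_seq
      apply Runs.skip_seq
      exact runs_pour (Γ := fun _ : Stack => Bool) (by decide) id _
    · simp
    · simp
  | cons b l =>
    apply Runs.conv
    · apply Runs.case_seq
      simp only [st, update_inp, List.head?_cons]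
      apply Runs.assoc
      apply Runs.push_seq
      simp only [st, update_sgn]
      apply Runs.push_seq
      exact runs_pour (Γ := fun _ : Stack => Bool) (by decide) id _
    · simp
    · simp
      omega

/-- Horner's scheme in unary: the counter is doubled and the next bit is added. Intermediate values
never exceed the final one, so `N` bounds the cost of every round. -/
theorem runs_unary (g : List Bool) (l : List Bool) : ∀ u N : ℕ,
    l.foldl (fun u b => b.toNat + 2 * u) u ≤ N →
    Runs unary (st [] g l (List.replicate u true) [] [] [] [] [] [] [] [] [])
      (st [] g [] (List.replicate (l.foldl (fun u b => b.toNat + 2 * u) u) true)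
        [] [] [] [] [] [] [] [] []) (l.length * (7 * N + 6) + 1) := by
  induction l with
  | nil => exact fun u N _ => (runs_loop_nil rfl).mono (by simp)
  | cons b l ih =>
    intro u N hN
    rw [List.foldl_cons] at hN ⊢
    have hle : ∀ (l : List Bool) v, v ≤ l.foldl (fun u b => b.toNat + 2 * u) v := by
      intro l
      induction l with
      | nil => simp
      | cons b l ih => exact fun v => (by omega : v ≤ b.toNat + 2 * v).trans (ih _)
    have hu := hle l (b.toNat + 2 * u)
    apply Runs.mono
    · refine Runs.loop_cons (a := b) (l := l) (T₁ := 7 * u + 4) rfl ?_ (ih _ N hN)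
      simp only [update_rv]
      apply Runs.conv
      · apply Runs.copy_seq rfl (by decide) (by decide) (by decide)
        apply Runs.pour_seq (by decide)
        simp only [st, update_aux, update_cnt]
        show Runs _ _ (st [] g l (List.replicate (b.toNat + 2 * u) true)
          [] [] [] [] [] [] [] [] []) 1
        cases b
        · apply Runs.conv
          · exact runs_skip _
          · simp [two_mul]
          · exact le_rfl
        · apply Runs.conv
          · exact runs_push _ _ _
          · simp [two_mul, add_comm 1, List.replicate_succ]
          · exact le_rfl
      · rfl
      · simp
        omega
    · rw [List.length_cons]
      nlinarith

/-- The accumulator gets (n+1)² bits, room for n+1 digits in base 2^(n+1), and the value 1. `len`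
holds the digit width and `off` the first shift. -/
theorem runs_prepare (g : List Bool) (n : ℕ) :
    Runs prepare (st [] g [] (List.replicate n true) [] [] [] [] [] [] [] [] [])
      (st [] g [] (List.replicate n true) (List.replicate (n + 1) true) []
        (true :: List.replicate ((n + 1) * (n + 1) - 1) false) [] [] []
        (List.replicate (n + 1) true) [] []) (5 * n * (n + 1) + 21 * n + 23) := by
  have hloop := runs_loop_foldl (Γ := fun _ : Stack => Bool) (k := .cnt)
    (f := fun _ => copy .len .acc .tmp (fun _ => false) ;; push .aux true)
    (fun (x : ℕ) (_ : Bool) => x + 1)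
    (fun x l => st [] g [] l (List.replicate (n + 1) true) []
        (List.replicate (x * (n + 1)) false) [] [] []
        (List.replicate (n + 1) true) (List.replicate x true) []) (fun _ _ => True)
    (5 * (n + 1) + 3) (fun _ _ => rfl) (fun x a l _ => ⟨trivial, ?_⟩)
    (List.replicate n true) 0 trivial
  · have hfold : (List.replicate n true).foldl (fun (x : ℕ) (_ : Bool) => x + 1) 0 = n := by
      simp
    rw [hfold] at hloop
    apply Runs.conv
    · apply Runs.copy_seq rfl (by decide) (by decide) (by decide)
      apply Runs.push_seq
      simp only [st, update_len]
      apply Runs.copy_seq rfl (by decide) (by decide) (by decide)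
      simp only [st, update_off, List.map_id_fun, id, List.reverse_replicate, List.append_nil,
        ← List.replicate_succ]
      apply Runs.seq
      · simpa using hloop
      apply Runs.pour_seq (by decide)
      simp only [st, update_cnt, update_aux]
      apply Runs.copy_seq rfl (by decide) (by decide) (by decide)
      simp only [st, update_acc]
      apply Runs.case_seq
      apply Runs.skip_seq
      exact runs_push _ _ _
    · have h1 : n + 1 + n * (n + 1) - 1 = (n + 1) * (n + 1) - 1 := by
        congr 1
        ring
      simp [h1]
    · simp
      nlinarith
  · apply Runs.conv
    · apply Runs.copy_seq rfl (by decide) (by decide) (by decide)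
      exact runs_push _ _ _
    · have h : List.replicate ((x + 1) * (n + 1)) false =
          List.replicate (n + 1) false ++ List.replicate (x * (n + 1)) false := by
        rw [← List.replicate_add]
        congr 1
        ring
      simp only [st, update_cnt, update_acc, update_aux, List.map_replicate,
        List.reverse_replicate, h, List.replicate_succ (n := x)]
    · simp

theorem runs_addLoop {g u v s : List Bool} (a : List Bool) : ∀ (d e : List Bool) (c : Bool),
    ∃ (a' d' : List Bool) (c' : Bool) (x : ℕ), a'.length = a.length ∧ d'.length ≤ d.length ∧
      bitsVal a' + 2 ^ a.length * x = bitsVal a + bitsVal d + c.toNat ∧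
      Runs addLoop (st [] g [] u v [] a [] d e s [] [c])
        (st [] g [] u v [] [] [] d' (a'.reverse ++ e) s [] [c']) (5 * a.length + 1) := by
  induction a with
  | nil =>
    intro d e c
    exact ⟨[], d, c, bitsVal d + c.toNat, rfl, le_rfl, by simp [bitsVal], runs_loop_nil rfl⟩
  | cons b a ih =>
    intro d e c
    obtain ⟨a', d', c', x, h₁, h₂, h₃, h₄⟩ := ih d.tail ((b ^^ d.head?.getD false ^^ c) :: e)
      (bif b then d.head?.getD false || c else d.head?.getD false && c)
    refine ⟨(b ^^ d.head?.getD false ^^ c) :: a', d', c', x, by simp [h₁],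
      h₂.trans (by simp), ?_, ?_⟩
    · have hd : bitsVal d = (d.head?.getD false).toNat + 2 * bitsVal d.tail := by
        cases d <;> simp [bitsVal]
      rw [bitsVal, bitsVal, hd, List.length_cons, pow_succ, mul_right_comm]
      generalize d.head?.getD false = y at h₃ ⊢
      generalize 2 ^ a.length * x = z at h₃ ⊢
      cases b <;> cases c <;> cases y <;> simp at h₃ ⊢ <;> omega
    · apply Runs.conv
      · refine Runs.loop_cons (a := b) (l := a) (T₁ := 4) rfl ?_ h₄
        refine Runs.case (T := 3) (.case (T := 2) (.push_seq (T := 1) ?_))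
        apply Runs.conv
        · exact runs_push _ _ _
        · simp
        · exact le_rfl
      · simp
      · simp
        omega

/-- Padding a copy with zeros multiplies it by a power of two. The adder runs only along `acc`, so
overflow is dropped and the result is reduced modulo 2^length. Pouring to `buf` reverses the digits,
which compensates for the reversal made by `copy`. -/
theorem runs_shiftAdd (g u v a s : List Bool) :
    ∃ a' : List Bool, a'.length = a.length ∧
      bitsVal a' = (bitsVal a * (1 + 2 ^ s.length)) % 2 ^ a.length ∧
      Runs shiftAdd (st [] g [] u v [] a [] [] [] s [] [])
        (st [] g [] u v [] a' [] [] [] s [] []) (20 * a.length + 7 * s.length + 20) := by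
  obtain ⟨a', d', c', x, h₁, h₂, h₃, h₄⟩ := runs_addLoop (g := g) (u := u) (v := v) (s := s) a
    (List.replicate s.length false ++ a) [] false
  refine ⟨a', h₁, ?_, ?_⟩
  · rw [bitsVal_append, bitsVal_replicate_false, List.length_replicate] at h₃
    have h5 : bitsVal a * (1 + 2 ^ s.length) = bitsVal a' + 2 ^ a.length * x := by
      rw [h₃, Bool.toNat_false]
      ring
    rw [h5, Nat.add_mul_mod_self_left, Nat.mod_eq_of_lt]
    exact h₁ ▸ bitsVal_lt a'
  · apply Runs.conv
    · apply Runs.pour_seq (by decide)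
      simp only [st, update_acc, update_buf]
      apply Runs.copy_seq rfl (by decide) (by decide) (by decide)
      simp only [st, update_shf]
      apply Runs.pour_seq (by decide)
      simp only [st, update_acc, update_buf]
      apply Runs.copy_seq rfl (by decide) (by decide) (by decide)
      simp only [st, update_shf]
      apply Runs.push_seq
      simp only [st, update_car]
      apply Runs.seq
      · simpa using h₄
      apply Runs.clear_seq
      simp only [update_car]
      apply Runs.clear_seq
      simp only [update_shf]
      exact runs_pour (Γ := fun _ : Stack => Bool) (by decide) id _
    · simp
    · simp at h₂ ⊢
      omega

theorem runs_main_loop (g : List Bool) (L : ℕ) (u : List Bool) : ∀ (a : List Bool) (s N : ℕ),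
    s + 2 * L * u.length ≤ N →
    ∃ (a' : List Bool) (s' : ℕ), a'.length = a.length ∧ s' ≤ N ∧
      bitsVal a' % 2 ^ a.length =
        (bitsVal a * ∏ k ∈ Finset.range u.length, (1 + 2 ^ (s + 2 * L * k))) % 2 ^ a.length ∧
      Runs (loop .cnt fun _ => shiftAdd ;; copy .len .off .tmp id ;; copy .len .off .tmp id)
        (st [] g [] u (List.replicate L true) [] a [] [] [] (List.replicate s true) [] [])
        (st [] g [] [] (List.replicate L true) [] a' [] [] [] (List.replicate s' true) [] [])
        (u.length * (20 * a.length + 7 * N + 10 * L + 25) + 1) := by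
  induction u with
  | nil =>
    intro a s N hN
    exact ⟨a, s, rfl, by simpa using hN, by simp, (runs_loop_nil rfl).mono (by simp)⟩
  | cons b u ih =>
    intro a s N hN
    rw [List.length_cons, mul_add, mul_one] at hN
    obtain ⟨a₁, h₁, h₂, h₃⟩ := runs_shiftAdd g u (List.replicate L true) a (List.replicate s true)
    rw [List.length_replicate] at h₂ h₃
    obtain ⟨a', s', h₄, h₅, h₆, h₇⟩ := ih a₁ (L + (L + s)) N (by omega)
    refine ⟨a', s', h₄.trans h₁, h₅, ?_, ?_⟩
    · rw [h₁] at h₆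
      -- The round just executed supplies the factor k = 0; the others are those of the remaining
      -- rounds, whose shift starts 2L higher.
      rw [h₆, h₂, Nat.mod_mul_mod, List.length_cons, Finset.prod_range_succ', mul_zero, add_zero,
        mul_comm (Finset.prod _ _), ← mul_assoc]
      congr 2
      refine Finset.prod_congr rfl fun k _ => ?_
      congr 2
      ring
    · rw [h₁] at h₇
      apply Runs.mono
      · refine Runs.loop_cons (a := b) (l := u) (T₁ := 20 * a.length + 7 * s + 10 * L + 24)
          rfl ?_ h₇
        simp only [update_cnt]
        apply Runs.conv
        · apply h₃.seq
          apply Runs.copy_seq rfl (by decide) (by decide) (by decide)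
          exact runs_copy (by decide) (by decide) (by decide) id _ rfl
        · simp
        · simp
          omega
      · rw [List.length_cons]
        nlinarith

/-- Here `y` is the top block of the accumulator. Pouring makes its most significant bit come first,
and `len` counts the bits to be read; `encodeStep` drops the leading zeros, so the output is the
canonical code. -/
theorem runs_extract (g s x y : List Bool) :
    Runs extract (st [] g [] [] (List.replicate y.length true) [] (x ++ y) [] [] [] s [] [])
      (st [] g [] [] [] [] (Computability.encodeNat (bitsVal y)) [] [] x.reverse s [] [])
      (2 * x.length + 7 * y.length + 2) := by
  have hloop := runs_loop_foldl (Γ := fun _ : Stack => Bool) (k := .len)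
    (f := fun _ => case .sum fun b =>
      bif b.getD false then push .acc true
      else case .acc fun a =>
        match a with
        | none => skip
        | some a => push .acc a ;; push .acc false)
    (fun (x : List Bool × List Bool) (_ : Bool) =>
      (encodeStep x.1 (x.2.head?.getD false), x.2.tail))
    (fun x l => st [] g [] [] l [] x.1 [] [] x.2 s [] []) (fun _ _ => True)
    4 (fun _ _ => rfl) (fun x a l _ => ⟨trivial, ?_⟩)
    (List.replicate y.length true) ([], (x ++ y).reverse) trivial
  · have hfold : ∀ (z w m : List Bool), (List.replicate z.length true).foldl
        (fun (x : List Bool × List Bool) (_ : Bool) =>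
          (encodeStep x.1 (x.2.head?.getD false), x.2.tail)) (m, z ++ w) =
        (z.foldl encodeStep m, w) := by
      intro z w
      induction z with
      | nil => simp
      | cons b z ih => intro m; simp [List.replicate_succ, ih]
    have h := hfold y.reverse x.reverse []
    rw [List.length_reverse, List.foldl_reverse, foldr_encodeStep] at h
    rw [List.reverse_append, h] at hloop
    apply Runs.conv
    · apply Runs.pour_seq (by decide)
      simp only [st, update_acc, update_sum]
      simpa using hloop
    · rfl
    · simp
      omega
  · simp only [update_len]
    refine Runs.case (T := 3) ?_
    simp only [st, update_sum]
    cases x.2.head?.getD false with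
    | true =>
      apply Runs.conv
      · exact runs_push _ _ _
      · simp [encodeStep]
      · simp
    | false =>
      refine Runs.case (T := 2) ?_
      simp only [st, update_acc]
      cases x.1 with
      | nil => simpa [encodeStep] using (runs_skip _).mono one_le_two
      | cons b m =>
        apply Runs.conv
        · exact Runs.push_seq (runs_push _ _ _)
        · simp [encodeStep]
        · simp

theorem bitsVal_drop (l : List Bool) (k : ℕ) (hk : k ≤ l.length) :
    bitsVal (l.drop k) = bitsVal l / 2 ^ k := by
  have h := bitsVal_append (l.take k) (l.drop k)
  have hlt := bitsVal_lt (l.take k)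
  rw [List.take_append_drop, List.length_take, min_eq_left hk] at h
  rw [List.length_take, min_eq_left hk] at hlt
  rw [h, Nat.add_mul_div_left _ _ (by positivity), Nat.div_eq_of_lt hlt, zero_add]

theorem runs_prog (l : List Bool) (n : ℕ) (hl : bitsVal l = n) (hlen : l.length ≤ 2 * n) :
    Runs prog (st l [] [] [] [] [] [] [] [] [] [] [] [])
      (st [] [] [] [] [] []
        (l.head?.getD false :: Computability.encodeNat
          ((∏ k ∈ Finset.range n, (1 + 2 ^ ((n + 1) * (2 * k + 1)))) %
            (2 ^ (n + 1)) ^ (n + 1) / (2 ^ (n + 1)) ^ n))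
        [] [] [] [] [] []) (300 * (n + 1) ^ 3) := by
  set g := [l.head?.getD false] with hg
  have h₁ := runs_readInput l
  have h₂ := runs_unary g l.reverse 0 n (by rw [foldl_reverse_bits, hl])
  rw [foldl_reverse_bits, hl, List.length_reverse] at h₂
  have h₃ := runs_prepare g n
  obtain ⟨a, s, ha, hs, hv, h₄⟩ := runs_main_loop g (n + 1) (List.replicate n true)
    (true :: List.replicate ((n + 1) * (n + 1) - 1) false) (n + 1)
    (n + 1 + 2 * (n + 1) * n) (by simp)
  have hW : (true :: List.replicate ((n + 1) * (n + 1) - 1) false).length = (n + 1) * (n + 1) := by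
    rw [List.length_cons, List.length_replicate]
    have : 0 < (n + 1) * (n + 1) := by positivity
    omega
  rw [hW] at ha hv h₄
  rw [List.length_replicate] at hv h₄
  have hlt := bitsVal_lt a
  rw [ha] at hlt
  rw [Nat.mod_eq_of_lt hlt, bitsVal, bitsVal_replicate_false, Bool.toNat_true, mul_zero, add_zero,
    one_mul] at hv
  have hle : (n + 1) * n ≤ a.length := by rw [ha]; exact Nat.mul_le_mul_left _ (by omega)
  have h₅ := runs_extract g (List.replicate s true) (a.take ((n + 1) * n)) (a.drop ((n + 1) * n))
  have hd : (a.drop ((n + 1) * n)).length = n + 1 := by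
    rw [List.length_drop, ha, ← Nat.mul_sub]
    simp
  rw [List.take_append_drop, hd, bitsVal_drop a _ hle, List.length_take, min_eq_left hle] at h₅
  have hval : bitsVal a / 2 ^ ((n + 1) * n) =
      (∏ k ∈ Finset.range n, (1 + 2 ^ ((n + 1) * (2 * k + 1)))) %
        (2 ^ (n + 1)) ^ (n + 1) / (2 ^ (n + 1)) ^ n := by
    rw [hv, ← pow_mul, ← pow_mul]
    congr 2
    refine Finset.prod_congr rfl fun k _ => ?_
    congr 2
    ring
  rw [hval] at h₅
  apply Runs.conv
  · apply h₁.seq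
    apply h₂.seq
    apply h₃.seq
    apply h₄.seq
    apply h₅.seq
    apply Runs.case_seq
    simp only [st, update_sgn]
    apply Runs.push_seq
    simp only [st, update_acc]
    apply Runs.clear_seq
    simp only [update_off]
    exact runs_clear _ _
  · simp [hg]
  · simp only [st, List.length_replicate, List.length_reverse, List.length_take, min_eq_left hle]
    have h6 : l.length * (7 * n + 6) ≤ 2 * n * (7 * n + 6) := Nat.mul_le_mul_right _ hlen
    have h7 : 0 ≤ n ^ 2 := by positivity
    have h8 : 0 ≤ n ^ 3 := by positivity
    nlinarith

end DigitMachine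

/-! ### Partitions into distinct odd parts as digits of a product -/

/-- Coefficients below B produce no carries: they are the base-B digits of the value at B. -/
theorem Polynomial.eval_mod_div_pow {B : ℕ} (n : ℕ) : ∀ f : Polynomial ℕ, (∀ i, f.coeff i < B) →
    f.eval B % B ^ (n + 1) / B ^ n = f.coeff n := by
  suffices h : ∀ f : Polynomial ℕ, (∀ i, f.coeff i < B) → f.eval B / B ^ n % B = f.coeff n by
    intro f hf
    rw [pow_succ, Nat.mod_mul_right_div_self, h f hf]
  induction n with
  | zero =>
    intro f hf
    conv_lhs => rw [← f.divX_mul_X_add]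
    simp [Nat.add_mod, Nat.mod_eq_of_lt (hf 0)]
  | succ n ih =>
    intro f hf
    have h := ih f.divX fun i => by simpa using hf (i + 1)
    rw [Polynomial.coeff_divX] at h
    rw [← h]
    conv_lhs => rw [← f.divX_mul_X_add]
    have hB : 0 < B := (Nat.zero_le _).trans_lt (hf 0)
    rw [pow_succ', ← Nat.div_div_eq_div_mul, Polynomial.eval_add, Polynomial.eval_mul,
      Polynomial.eval_X, Polynomial.eval_C, add_comm, Nat.add_mul_div_right _ _ hB,
      Nat.div_eq_of_lt (hf 0), zero_add]

theorem Polynomial.coeff_le_eval_one (f : Polynomial ℕ) (i : ℕ) : f.coeff i ≤ f.eval 1 := by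
  rw [Polynomial.eval_eq_sum]
  simp only [one_pow, mul_one]
  by_cases hi : i ∈ f.support
  · exact Finset.single_le_sum (f := f.coeff) (fun _ _ => Nat.zero_le _) hi
  · rw [Polynomial.notMem_support_iff.1 hi]
    exact Nat.zero_le _

theorem coeff_prod_eq_qOdd (n : ℕ) :
    (∏ k ∈ Finset.range n, (1 + Polynomial.X ^ (2 * k + 1) : Polynomial ℕ)).coeff n = qOdd n := by
  have h := hasProd_one_add_X_pow_odd.tendsto_prod_nat
  rw [PowerSeries.WithPiTopology.tendsto_iff_coeff_tendsto] at h
  have h1 := h n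
  rw [PowerSeries.coeff_mk, nhds_discrete, Filter.tendsto_pure] at h1
  obtain ⟨N, hN⟩ := Filter.eventually_atTop.1 h1
  -- Factors with k ≥ n have exponent 2k + 1 > n and do not affect the coefficient.
  have h2 : ∀ m, PowerSeries.coeff n (∏ k ∈ Finset.range (n + m),
      (1 + PowerSeries.X ^ (2 * k + 1) : ℤ⟦X⟧)) = PowerSeries.coeff n (∏ k ∈ Finset.range n,
      (1 + PowerSeries.X ^ (2 * k + 1) : ℤ⟦X⟧)) := by
    intro m
    induction m with
    | zero => rfl
    | succ m ih =>
      rw [← add_assoc, Finset.prod_range_succ, mul_add, mul_one, map_add, ih,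
        PowerSeries.coeff_mul_X_pow', if_neg (by omega), add_zero]
  have h3 := hN (n + N) (by omega)
  rw [h2] at h3
  have h4 : (∏ k ∈ Finset.range n, (1 + PowerSeries.X ^ (2 * k + 1) : ℤ⟦X⟧)) =
      (((∏ k ∈ Finset.range n, (1 + Polynomial.X ^ (2 * k + 1) : Polynomial ℕ)).map
        (Nat.castRingHom ℤ) : Polynomial ℤ) : ℤ⟦X⟧) := by
    rw [Polynomial.map_prod, ← Polynomial.coeToPowerSeries.ringHom_apply, map_prod]
    simp
  rw [h4, Polynomial.coeff_coe, Polynomial.coeff_map] at h3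
  exact Nat.cast_injective (R := ℤ) h3

theorem qOdd_eq_digit (n : ℕ) :
    (∏ k ∈ Finset.range n, (1 + 2 ^ ((n + 1) * (2 * k + 1)))) %
      (2 ^ (n + 1)) ^ (n + 1) / (2 ^ (n + 1)) ^ n = qOdd n := by
  have h := Polynomial.eval_mod_div_pow (B := 2 ^ (n + 1)) n
    (∏ k ∈ Finset.range n, (1 + Polynomial.X ^ (2 * k + 1) : Polynomial ℕ)) fun i => by
      -- The value at 1 is 2^n, below the base 2^(n+1).
      refine (Polynomial.coeff_le_eval_one _ i).trans_lt ?_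
      simp [Polynomial.eval_prod, pow_succ]
  rw [coeff_prod_eq_qOdd, Polynomial.eval_prod] at h
  simpa [← pow_mul] using h

/-! ### Many partitions into distinct odd parts -/

theorem card_le_qOdd {n : ℕ} (F : Finset (Finset ℕ))
    (hF : ∀ s ∈ F, (∀ i ∈ s, Odd i) ∧ ∑ i ∈ s, i = n) : F.card ≤ qOdd n := by
  unfold qOdd
  have hpos : ∀ s ∈ F, ∀ {i}, i ∈ s.val → 0 < i := fun s hs i hi => ((hF s hs).1 i hi).pos
  refine Finset.card_le_card_of_injOn
    (fun s => if hs : s ∈ F then ⟨s.val, hpos s hs, by simpa using (hF s hs).2⟩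
      else Nat.Partition.indiscrete n) ?_ ?_
  · intro s hs
    rw [Finset.mem_coe] at hs
    simp only [dif_pos hs, Nat.Partition.oddDistincts, Nat.Partition.odds,
      Nat.Partition.restricted, Nat.Partition.distincts, Finset.coe_inter, Set.mem_inter_iff,
      Finset.mem_coe, Finset.mem_filter, Finset.mem_univ, true_and]
    exact ⟨fun i hi => Nat.not_even_iff_odd.2 ((hF s hs).1 i hi), s.nodup⟩
  · intro s hs t ht h
    rw [Finset.mem_coe] at hs ht
    simp only [dif_pos hs, dif_pos ht, Nat.Partition.mk.injEq] at h
    exact Finset.val_injective h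

theorem sum_odd_le {m : ℕ} {s : Finset ℕ} (hs : s ⊆ Finset.range m) :
    ∑ i ∈ s, (2 * i + 3) ≤ m ^ 2 + 2 * m := by
  refine (Finset.sum_le_sum_of_subset hs).trans (le_of_eq ?_)
  clear hs
  induction m with
  | zero => rfl
  | succ m ih => rw [Finset.sum_range_succ, ih]; ring

/-- Each subset s of {0, …, m-1} yields its own partition: take the parts 2i + 3 for i in s and fill
up with the rest t of n, as t itself if t is odd and as 1 + (t-1) otherwise. The hypothesis gives t
≥ 2m + 3, so the filling parts are 1 or at least 2m + 3, hence distinct from the others, and s can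
be recovered. -/
theorem two_pow_le_qOdd {n m : ℕ} (h : m ^ 2 + 4 * m + 3 ≤ n) : 2 ^ m ≤ qOdd n := by
  set body : Finset ℕ → Finset ℕ := fun s => s.image fun i => 2 * i + 3 with hbody
  set tail : ℕ → Finset ℕ := fun t => if Odd t then {t} else {1, t - 1} with htail
  set rest : Finset ℕ → ℕ := fun s => n - ∑ i ∈ s, (2 * i + 3) with hrest
  have hinj : Function.Injective fun i : ℕ => 2 * i + 3 := fun a b hab => by
    simp only at hab; omega
  have hge : ∀ s ⊆ Finset.range m, 2 * m + 3 ≤ rest s := fun s hs => by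
    have := sum_odd_le hs
    simp only [hrest]
    omega
  have hmem : ∀ t, 2 * m + 3 ≤ t → ∀ i ∈ tail t, Odd i ∧ (i = 1 ∨ 2 * m + 3 ≤ i) := by
    intro t ht i hi
    simp only [htail] at hi
    split_ifs at hi with ho
    · rw [Finset.mem_singleton] at hi
      exact hi ▸ ⟨ho, .inr ht⟩
    · rw [Nat.not_odd_iff_even] at ho
      obtain ⟨r, hr⟩ := ho
      rw [Finset.mem_insert, Finset.mem_singleton] at hi
      rcases hi with rfl | rfl
      · exact ⟨odd_one, .inl rfl⟩
      · exact ⟨⟨r - 1, by omega⟩, .inr (by omega)⟩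
  have hsum : ∀ t, 2 * m + 3 ≤ t → ∑ i ∈ tail t, i = t := by
    intro t ht
    simp only [htail]
    split_ifs
    · simp
    · rw [Finset.sum_pair (by omega)]
      omega
  have hbm : ∀ s ⊆ Finset.range m, ∀ i ∈ body s, Odd i ∧ i ≠ 1 ∧ i < 2 * m + 3 := by
    intro s hs i hi
    obtain ⟨j, hj, rfl⟩ := Finset.mem_image.1 hi
    have := Finset.mem_range.1 (hs hj)
    exact ⟨⟨j + 1, by ring⟩, by omega, by omega⟩
  have hdisj : ∀ s ⊆ Finset.range m, Disjoint (body s) (tail (rest s)) := by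
    intro s hs
    rw [Finset.disjoint_left]
    intro i hi hi'
    have h1 := hbm s hs i hi
    have h2 := hmem _ (hge s hs) i hi'
    omega
  have hfilter : ∀ s ⊆ Finset.range m,
      {i ∈ Finset.range m | 2 * i + 3 ∈ body s ∪ tail (rest s)} = s := by
    intro s hs
    ext i
    rw [Finset.mem_filter, Finset.mem_union, Finset.mem_range]
    constructor
    · rintro ⟨hi, hb | ht⟩
      · obtain ⟨j, hj, hji⟩ := Finset.mem_image.1 hb
        rwa [← hinj hji]
      · have := hmem _ (hge s hs) _ ht
        omega
    · exact fun hi => ⟨Finset.mem_range.1 (hs hi), .inl (Finset.mem_image_of_mem _ hi)⟩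
  have hcard := card_le_qOdd (n := n)
    ((Finset.range m).powerset.image fun s => body s ∪ tail (rest s)) ?_
  · rwa [Finset.card_image_of_injOn, Finset.card_powerset, Finset.card_range] at hcard
    intro s hs t ht hst
    rw [Finset.mem_coe, Finset.mem_powerset] at hs ht
    rw [← hfilter s hs, ← hfilter t ht]
    simp only at hst
    rw [hst]
  · intro F hF
    obtain ⟨s, hs, rfl⟩ := Finset.mem_image.1 hF
    rw [Finset.mem_powerset] at hs
    refine ⟨fun i hi => ?_, ?_⟩
    · rcases Finset.mem_union.1 hi with hi | hi
      · exact (hbm s hs i hi).1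
      · exact (hmem _ (hge s hs) i hi).1
    · rw [Finset.sum_union (hdisj s hs), hsum _ (hge s hs), hbody,
        Finset.sum_image fun a _ b _ hab => hinj hab]
      have := sum_odd_le hs
      simp only [hrest]
      omega

theorem qOdd_pos_of_odd {n : ℕ} (h : Odd n) : 0 < qOdd n := by
  have := card_le_qOdd (n := n) {{n}} (by simpa using h)
  rwa [Finset.card_singleton] at this

/-! ### Complexity of the signed count of all partitions -/

theorem abs_pSigned (n : ℕ) : |pSigned n| = qOdd n := by
  rw [pSigned_eq, abs_mul, abs_pow, abs_neg, abs_one, one_pow, one_mul, Nat.abs_cast]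

theorem succ_le_inOutSize_pSigned (n : ℕ) : (n + 1 : ℝ) ≤ 64 * inOutSize pSigned n ^ 2 := by
  set x := inOutSize pSigned n with hx
  have hlog := Real.log_two_gt_d9
  have hx0 : 1 / 2 ≤ x := (log_two_add_ge n).trans (log_two_add_le_inOutSize _ _)
  have hs : (Nat.sqrt n : ℝ) ≤ 2 * x + 2 := by
    by_cases h2 : Nat.sqrt n < 2
    · have : (Nat.sqrt n : ℝ) < 2 := by exact_mod_cast h2
      linarith
    · obtain ⟨m, hm⟩ := Nat.exists_eq_add_of_le (not_lt.1 h2)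
      have hn : m ^ 2 + 4 * m + 3 ≤ n := by
        have := Nat.sqrt_le' n
        rw [hm] at this
        nlinarith
      have h3 : (2 : ℝ) ^ m ≤ 2 + |(pSigned n : ℝ)| := by
        have h4 : |(pSigned n : ℝ)| = qOdd n := by exact_mod_cast abs_pSigned n
        have h5 : (2 : ℝ) ^ m ≤ qOdd n := by exact_mod_cast two_pow_le_qOdd hn
        linarith
      have h4 := Real.log_le_log (by positivity) h3
      rw [Real.log_pow] at h4
      have h5 : 0 ≤ Real.log (1 + (n : ℝ)) := Real.log_nonneg (by simp)
      have h6 : (m : ℝ) * Real.log 2 ≤ x := by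
        rw [hx, inOutSize]
        linarith
      rw [hm]
      push_cast
      nlinarith [(Nat.cast_nonneg m : (0 : ℝ) ≤ m)]
  have h1 : (n + 1 : ℝ) ≤ (Nat.sqrt n + 1) ^ 2 := by
    exact_mod_cast Nat.succ_le_succ_sqrt' n
  have h2 : (Nat.sqrt n + 1 : ℝ) ≤ 8 * x := by linarith
  calc (n + 1 : ℝ) ≤ (Nat.sqrt n + 1) ^ 2 := h1
    _ ≤ (8 * x) ^ 2 := by gcongr
    _ = 64 * x ^ 2 := by ring

theorem head_encodeNat (n : ℕ) :
    (Computability.encodeNat n).head?.getD false = decide (n % 2 = 1) := by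
  obtain ⟨m, rfl | rfl⟩ := Nat.even_or_odd' n
  · rw [encodeNat_bit0]
    split_ifs <;> simp
  · rw [encodeNat_bit1]
    simp

/-- The sign bit is the parity of n. For odd n this needs `qOdd n` to be nonzero, which the one-part
partition ensures. -/
theorem encodeInt_pSigned (n : ℕ) :
    encodeInt (pSigned n) = decide (n % 2 = 1) :: Computability.encodeNat (qOdd n) := by
  have h : (pSigned n).natAbs = qOdd n := by
    zify
    exact abs_pSigned n
  rw [encodeInt, h, pSigned_eq]
  congr 2
  rcases Nat.even_or_odd n with he | ho
  · rw [he.neg_one_pow, one_mul, eq_iff_iff]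
    rw [Nat.even_iff] at he
    omega
  · have := qOdd_pos_of_odd ho
    rw [ho.neg_one_pow, eq_iff_iff]
    rw [Nat.odd_iff] at ho
    omega

theorem isPIO_pSigned : IsPIO pSigned := by
  -- The constant is 301 · 64³, from the running time 300(n+1)³ + 1 and n + 1 ≤ 64 x².
  refine ⟨78905344, 6, by norm_num, by norm_num,
    .of_runs DigitMachine.prog .inp .acc (Equiv.refl _) (Equiv.refl _) fun n => ?_⟩
  refine ⟨300 * (n + 1) ^ 3, ?_, ?_⟩
  · have h := succ_le_inOutSize_pSigned n
    have h1 : (1 : ℝ) ≤ (n + 1 : ℝ) ^ 3 := one_le_pow₀ (by simp)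
    push_cast
    calc (300 * (n + 1) ^ 3 + 1 : ℝ) ≤ 301 * (n + 1) ^ 3 := by linarith
      _ ≤ 301 * (64 * inOutSize pSigned n ^ 2) ^ 3 := by gcongr
      _ = 78905344 * inOutSize pSigned n ^ 6 := by ring
  · have hlen : (Computability.encodeNat n).length ≤ 2 * n := by
      have h1 := two_pow_length_encodeNat_le n
      have h2 := (Computability.encodeNat n).length.lt_two_pow_self
      omega
    have h := DigitMachine.runs_prog _ n (bitsVal_encodeNat n) hlen
    rw [qOdd_eq_digit, head_encodeNat, ← encodeInt_pSigned] at h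
    rw [DigitMachine.st_nil, DigitMachine.update_inp, DigitMachine.update_acc]
    simpa using h

theorem mainTheorem11 :
    -- both signed counts are PIO functions
    IsPIO qSigned ∧ IsPIO pSigned ∧
    -- the first one is even computable in poly(log n) steps
    (∃ c d : ℕ, ComputableWithin qSigned (fun n => (c : ℝ) * Real.log (2 + (n : ℝ)) ^ d)) ∧
    -- Euler's pentagonal identity
    HasProd (fun k : ℕ => (1 - PowerSeries.X ^ (k + 1) : ℤ⟦X⟧)) (PowerSeries.mk qSigned) ∧
    HasSum
      (fun j : ℕ => ((-1) ^ (j + 1) *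
        (PowerSeries.X ^ ((j + 1) * (3 * (j + 1) - 1) / 2) +
          PowerSeries.X ^ ((j + 1) * (3 * (j + 1) + 1) / 2)) : ℤ⟦X⟧))
      (PowerSeries.mk qSigned - 1) ∧
    -- Glaisher's identity
    HasProd (fun k : ℕ => PowerSeries.invOfUnit (1 + PowerSeries.X ^ (k + 1) : ℤ⟦X⟧) 1)
      (PowerSeries.mk pSigned) ∧
    HasProd (fun k : ℕ => (1 + (-PowerSeries.X) ^ (2 * (k + 1) - 1) : ℤ⟦X⟧))
      (PowerSeries.mk pSigned) ∧
    HasSum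
      (fun j : ℕ => ((-1) ^ (j + 1) * (qOdd (j + 1) : ℤ⟦X⟧) * PowerSeries.X ^ (j + 1) : ℤ⟦X⟧))
      (PowerSeries.mk pSigned - 1) :=
  ⟨isPIO_qSigned, isPIO_pSigned, ⟨_, _, computableWithin_qSigned⟩, hasProd_qSigned,
    hasSum_qSigned, hasProd_pSigned, hasProd_pSigned_odd, hasSum_pSigned⟩
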